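/- Let $3\le\alpha<\omega$. A \emph{polyadic-type algebra} of dimension $\alpha$ is an algebra $\mathcal A=\langle A,+,-,c_i,d_{ij},p_{ij}\rangle_{i,j<\alpha}$ with $+$ binary, $-,c_i,p_{ij}$ unary and $d_{ij}$ constants; its \emph{cylindric reduct} is $\langle A,+,-,c_i,d_{ij}\rangle_{i,j<\alpha}$. A \emph{variety} is the class of all algebras (of a given similarity type) in which some set of equations is true. For a set $U$ and $X\subseteq U^\alpha$ let $$C_iX=\{u\in U^\alpha:\ \exists u'\in X\ \forall j\neq i\ \ u_j=u'_j\},\qquad D_{ij}=\{u\in U^\alpha: u_i=u_j\},$$ $$P_{ij}X=\{u\in U^\alpha:\ \exists u'\in X\ \ u_i=u'_j,\ u_j=u'_i,\ u_l=u'_l\text{ for all }l\ne i,j\}.$$ A \emph{cylindric set algebra} (class $Cs_\alpha$) is a family of subsets of $U^\alpha$, for some set $U$, which contains all $D_{ij}$ and is closed under union $+$, complement $-$ with respect to $U^\alpha$, and all $C_i$, with these operations. A \emph{polyadic equality set algebra} (class $Pse_\alpha$) is defined in the same way, with the operations $P_{ij}$ in addition. Let $RPEA_\alpha$ be the class of all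 polyadic-type algebras in which all equations true in $Pse_\alpha$ are true. Let $RCPEA_\alpha$ be the class of all polyadic-type algebras whose cylindric reduct is representable, i.e. all equations true in $Cs_\alpha$ are true in the reduct, and in which the following equations are true for all $i,j,k,l<\alpha$, where $\tau$ is the transposition of $i$ and $j$ (the identity if $i=j$) and $x\cdot y=-(-x+-y)$: \begin{align*} &\text{(P1) } p_{ij}(x+y)=p_{ij}x+p_{ij}y, &&\text{(P2) } p_{ij}(-x)=-p_{ij}x,\\ &\text{(P3) } p_{ij}(c_kx)=c_{\tau(k)}p_{ij}x, &&\text{(P4) } p_{ij}d_{kl}=d_{\tau(k)\tau(l)},\\ &\text{(P5) } p_{ij}p_{kl}x=p_{\tau(k)\tau(l)}p_{ij}x, &&\text{(P6) } p_{ij}p_{ij}x=x,\\ &\text{(P7) } p_{ii}x=x, &&\text{(P8) } p_{ij}(x\cdot d_{ij})=x\cdot d_{ij}. \end{align*} \textbf{Theorem.} For each $3\le\alpha<\omega$ there are continuum many varieties between $RCPEA_\alpha$ and $RPEA_\alpha$: the collection of varieties $V$ of polyadic-type algebras of dimension $\alpha$ with $RPEA_\alpha\subseteq V\subseteq RCPEA_\alpha$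 has cardinality exactly $2^{\aleph_0}$. -/

import Mathlib

/-! Polyadic-type algebras of finite dimension `n`, their cylindric reducts, set algebras,
varieties, and the classes `RPEA` and `RCPEA`. -/

universe u

namespace PolyadicGap

open FirstOrder CategoryTheory

/-- The operation symbols `+`, `-`, `c_i`, `d_{ij}` of cylindric-type algebras,
indexed by their arity. -/
inductive CylFunc (n : ℕ) : ℕ → Type
  | add : CylFunc n 2
  | neg : CylFunc n 1
  | cyl (i : Fin n) : CylFunc n 1
  | diag (i j : Fin n) : CylFunc n 0

/-- The transposition symbols `p_{ij}`, all of them unary. -/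
inductive TranspFunc (n : ℕ) : ℕ → Type
  | transp (i j : Fin n) : TranspFunc n 1

/-- The signature of cylindric-type algebras. -/
def cylLang (n : ℕ) : FirstOrder.Language.{0, 0} := ⟨CylFunc n, fun _ => Empty⟩

/-- The signature consisting of the transpositions only. -/
def transpLang (n : ℕ) : FirstOrder.Language.{0, 0} := ⟨TranspFunc n, fun _ => Empty⟩

/-- The signature of polyadic-type algebras: `+`, `-`, `c_i`, `d_{ij}`, `p_{ij}`. -/
abbrev polyLang (n : ℕ) : FirstOrder.Language.{0, 0} := (cylLang n).sum (transpLang n)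

/-- The algebras of a signature, with carrier in `Type u`. -/
abbrev Alg (L : FirstOrder.Language.{0, 0}) : Type (u + 1) := Bundled.{u} L.Structure

/-- The cylindric (transposition-free) reduct of a polyadic-type algebra. -/
def cylReduct {n : ℕ} (A : Alg.{u} (polyLang n)) : Alg.{u} (cylLang n) :=
  ⟨A, (FirstOrder.Language.LHom.sumInl : cylLang n →ᴸ polyLang n).reduct A⟩

/-! ### Equations and varieties -/

/-- Equations (pairs of terms) in the algebraic variables `x_0, x_1, …`. -/
abbrev Equation (L : FirstOrder.Language.{0, 0}) : Type := L.Term ℕ × L.Term ℕ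

/-- The equation `e` is true in the algebra `A` (under all evaluations of the variables). -/
def TrueIn {L : FirstOrder.Language.{0, 0}} (A : Alg.{u} L) (e : Equation L) : Prop :=
  ∀ v : ℕ → A, e.1.realize v = e.2.realize v

/-- The class of all algebras in which all members of `E` are true. -/
def models {L : FirstOrder.Language.{0, 0}} (E : Set (Equation L)) : Set (Alg.{u} L) :=
  {A | ∀ e ∈ E, TrueIn A e}

/-- The set of all equations true in all members of `K`. -/
def eqTheory {L : FirstOrder.Language.{0, 0}} (K : Set (Alg.{u} L)) : Set (Equation L) :=
  {e | ∀ A ∈ K, TrueIn A e}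

/-- A variety is an equationally definable class of algebras. -/
def IsVariety {L : FirstOrder.Language.{0, 0}} (K : Set (Alg.{u} L)) : Prop :=
  ∃ E : Set (Equation L), K = models E

/-! ### Set algebras -/

/-- `C_i(X)`: the points that differ from some point of `X` at most at the coordinate `i`. -/
def setCyl {n : ℕ} {U : Type u} (i : Fin n) (X : Set (Fin n → U)) : Set (Fin n → U) :=
  {s | ∃ t ∈ X, ∀ j, j ≠ i → s j = t j}

/-- The diagonal `D_{ij}`. -/
def setDiag {n : ℕ} (U : Type u) (i j : Fin n) : Set (Fin n → U) :=
  {s | s i = s j}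

/-- `P_{ij}(X)`: the reflection of `X` to the `ij`-diagonal. -/
def setTransp {n : ℕ} {U : Type u} (i j : Fin n) (X : Set (Fin n → U)) : Set (Fin n → U) :=
  {s | ∃ t ∈ X, s i = t j ∧ s j = t i ∧ ∀ l, l ≠ i → l ≠ j → s l = t l}

/-- The full cylindric set algebra with base set `U`. -/
instance setCylStructure (n : ℕ) (U : Type u) : (cylLang n).Structure (Set (Fin n → U)) where
  funMap
    | CylFunc.add, x => x 0 ∪ x 1
    | CylFunc.neg, x => (x 0)ᶜ
    | CylFunc.cyl i, x => setCyl i (x 0)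
    | CylFunc.diag i j, _ => setDiag U i j
  RelMap r _ := r.elim

/-- The transposition operations of the full polyadic equality set algebra with base set `U`.
Together with the previous structure they make the power set of `U^n` an algebra
of signature `polyLang n`. -/
instance setTranspStructure (n : ℕ) (U : Type u) :
    (transpLang n).Structure (Set (Fin n → U)) where
  funMap
    | TranspFunc.transp i j, x => setTransp i j (x 0)
  RelMap r _ := r.elim

/-- The class `Cs_n` of cylindric set algebras: families of subsets of `U^n`, for any set `U`,
that contain the diagonals and are closed under union, complement and cylindrifications. -/
def Cs (n : ℕ) : Set (Alg.{u} (cylLang n)) :=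
  {A | ∃ (U : Type u) (S : (cylLang n).Substructure (Set (Fin n → U))), A = ⟨S, inferInstance⟩}

/-- The class `Pse_n` of polyadic equality set algebras: families of subsets of `U^n`, for any
set `U`, that contain the diagonals and are closed under union, complement, cylindrifications
and transpositions. -/
def Pse (n : ℕ) : Set (Alg.{u} (polyLang n)) :=
  {A | ∃ (U : Type u) (S : (polyLang n).Substructure (Set (Fin n → U))), A = ⟨S, inferInstance⟩}

/-! ### The operations of a polyadic-type algebra and the polyadic equations -/

section Ops

variable {n : ℕ} {A : Alg.{u} (polyLang n)}

/-- Boolean join `x + y`. -/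
def add (x y : A) : A :=
  FirstOrder.Language.Structure.funMap (L := polyLang n)
    (Sum.inl (CylFunc.add : CylFunc n 2)) ![x, y]

/-- Boolean complement `-x`. -/
def neg (x : A) : A :=
  FirstOrder.Language.Structure.funMap (L := polyLang n)
    (Sum.inl (CylFunc.neg : CylFunc n 1)) ![x]

/-- Cylindrification `c_i x`. -/
def cyl (i : Fin n) (x : A) : A :=
  FirstOrder.Language.Structure.funMap (L := polyLang n)
    (Sum.inl (CylFunc.cyl i)) ![x]

/-- Diagonal constant `d_{ij}`. -/
def diag (i j : Fin n) : A :=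
  FirstOrder.Language.Structure.funMap (L := polyLang n)
    (Sum.inl (CylFunc.diag i j)) ![]

/-- Transposition `p_{ij} x`. -/
def transp (i j : Fin n) (x : A) : A :=
  FirstOrder.Language.Structure.funMap (L := polyLang n)
    (Sum.inr (TranspFunc.transp i j)) ![x]

/-- Boolean meet `x · y`, as a derived operation. -/
def meet (x y : A) : A := neg (add (neg x) (neg y))

end Ops

/-- The polyadic equations (P1)--(P8) are true in `A`. -/
structure PolyadicEquations {n : ℕ} (A : Alg.{u} (polyLang n)) : Prop where
  p1 : ∀ (i j : Fin n) (x y : A), transp i j (add x y) = add (transp i j x) (transp i j y)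
  p2 : ∀ (i j : Fin n) (x : A), transp i j (neg x) = neg (transp i j x)
  p3 : ∀ (i j k : Fin n) (x : A),
    transp i j (cyl k x) = cyl (Equiv.swap i j k) (transp i j x)
  p4 : ∀ i j k l : Fin n,
    transp i j (diag k l : A) = diag (Equiv.swap i j k) (Equiv.swap i j l)
  p5 : ∀ (i j k l : Fin n) (x : A),
    transp i j (transp k l x) = transp (Equiv.swap i j k) (Equiv.swap i j l) (transp i j x)
  p6 : ∀ (i j : Fin n) (x : A), transp i j (transp i j x) = x
  p7 : ∀ (i : Fin n) (x : A), transp i i x = x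
  p8 : ∀ (i j : Fin n) (x : A), transp i j (meet x (diag i j)) = meet x (diag i j)

/-! ### The classes of representable algebras -/

/-- Representable cylindric algebras: all equations true in `Cs_n` are true in them. -/
def RCA (n : ℕ) : Set (Alg.{u} (cylLang n)) := models (eqTheory (Cs.{u} n))

/-- Representable polyadic equality algebras: all equations true in `Pse_n` are true in them. -/
def RPEA (n : ℕ) : Set (Alg.{u} (polyLang n)) := models (eqTheory (Pse.{u} n))

/-- Polyadic-type algebras with representable cylindric reduct in which (P1)--(P8) are true. -/
def RCPEA (n : ℕ) : Set (Alg.{u} (polyLang n)) :=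
  {A | cylReduct A ∈ RCA.{u} n ∧ PolyadicEquations A}

end PolyadicGap

/-! Write A_p for `twistedAlg` over the field F with p elements, p an odd prime. It lies in `RCPEA`,
and there is an equation e_p, true in `Pse`, that fails in A_p but holds in A_q for every odd prime
q ≠ p. Adding to the axioms of `RCPEA` the e_p with p in S therefore gives a different variety for
every set S of odd primes. Continuum many is also an upper bound, as there are only countably many
equations.

Construction. An injective tuple of two scalars and otherwise weights is coloured by the difference
of the scalars, taken in the order of their coordinates, times the product of the weights. Truly
interchanging the scalars would negate the colour; the twisted transposition keeps it. Changing any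
single coordinate within its sort can produce every colour (`HasColor.exists_update`), so
cylindrifications do not detect the twist and (P1)-(P8) survive (`Twisted.amalgam`).

Non-representability. The points of Sym(F) fix the number of scalars: a scalar is determined by its
image under a given permutation, and the cylindric operations can express this. So every cylindric
image over a nonempty base has exactly p scalars (`exists_scalars_eq_range`). If transpositions were
true ones, the p - 1 colours would be symmetric relations splitting the complete graph on p points
into perfect matchings, which is impossible for odd p (`not_isCylMap_of_transp`).

Independence. The equation e_p expresses that A_p has no homomorphism into the algebra
(`exists_equation_trueIn_iff`). A homomorphism from A_p to A_q would single out p points in the base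
of A_q, invariant under a translation of order q without fixed points; hence q divides p
(`card_eq_of_isPolyHom`). -/

namespace PolyadicGap

open FirstOrder CategoryTheory

/-! ### Terms and their values -/

section Terms

variable {n : ℕ}

/-- The term `s + t`. -/
def tAdd (s t : (polyLang n).Term ℕ) : (polyLang n).Term ℕ :=
  .func (l := 2) (Sum.inl CylFunc.add) ![s, t]

/-- The term `-t`. -/
def tNeg (t : (polyLang n).Term ℕ) : (polyLang n).Term ℕ :=
  .func (l := 1) (Sum.inl CylFunc.neg) ![t]

/-- The term `c_i t`. -/
def tCyl (i : Fin n) (t : (polyLang n).Term ℕ) : (polyLang n).Term ℕ :=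
  .func (l := 1) (Sum.inl (CylFunc.cyl i)) ![t]

/-- The term `d_{ij}`. -/
def tDiag (i j : Fin n) : (polyLang n).Term ℕ :=
  .func (l := 0) (Sum.inl (CylFunc.diag i j)) ![]

/-- The term `p_{ij} t`. -/
def tTransp (i j : Fin n) (t : (polyLang n).Term ℕ) : (polyLang n).Term ℕ :=
  .func (l := 1) (Sum.inr (TranspFunc.transp i j)) ![t]

/-- The term `s · t`. -/
def tMeet (s t : (polyLang n).Term ℕ) : (polyLang n).Term ℕ :=
  tNeg (tAdd (tNeg s) (tNeg t))

variable {A : Alg.{u} (polyLang n)} (v : ℕ → A) (s t : (polyLang n).Term ℕ) (i j : Fin n)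

@[simp] lemma realize_tAdd : (tAdd s t).realize v = add (s.realize v) (t.realize v) := by
  rw [tAdd, add]
  exact congrArg _ (funext fun k => by fin_cases k <;> rfl)

@[simp] lemma realize_tNeg : (tNeg t).realize v = neg (t.realize v) := by
  rw [tNeg, neg]
  exact congrArg _ (funext fun k => by fin_cases k; rfl)

@[simp] lemma realize_tCyl : (tCyl i t).realize v = cyl i (t.realize v) := by
  rw [tCyl, cyl]
  exact congrArg _ (funext fun k => by fin_cases k; rfl)

@[simp] lemma realize_tDiag : (tDiag i j).realize v = diag i j := by
  rw [tDiag, diag]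
  exact congrArg _ (funext fun k => k.elim0)

@[simp] lemma realize_tTransp : (tTransp i j t).realize v = transp i j (t.realize v) := by
  rw [tTransp, transp]
  exact congrArg _ (funext fun k => by fin_cases k; rfl)

@[simp] lemma realize_tMeet : (tMeet s t).realize v = meet (s.realize v) (t.realize v) := by
  simp [tMeet, meet]

end Terms

/-! ### `RCPEA` is a variety containing `RPEA` -/

section Variety

variable {n : ℕ}

/-- The equations (P1)--(P8) as pairs of terms. -/
inductive IsPolyadicEquation : Equation (polyLang n) → Prop
  | p1 (i j : Fin n) : IsPolyadicEquation
      (tTransp i j (tAdd (.var 0) (.var 1)), tAdd (tTransp i j (.var 0)) (tTransp i j (.var 1)))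
  | p2 (i j : Fin n) : IsPolyadicEquation
      (tTransp i j (tNeg (.var 0)), tNeg (tTransp i j (.var 0)))
  | p3 (i j k : Fin n) : IsPolyadicEquation
      (tTransp i j (tCyl k (.var 0)), tCyl (Equiv.swap i j k) (tTransp i j (.var 0)))
  | p4 (i j k l : Fin n) : IsPolyadicEquation
      (tTransp i j (tDiag k l), tDiag (Equiv.swap i j k) (Equiv.swap i j l))
  | p5 (i j k l : Fin n) : IsPolyadicEquation
      (tTransp i j (tTransp k l (.var 0)),
        tTransp (Equiv.swap i j k) (Equiv.swap i j l) (tTransp i j (.var 0)))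
  | p6 (i j : Fin n) : IsPolyadicEquation (tTransp i j (tTransp i j (.var 0)), .var 0)
  | p7 (i : Fin n) : IsPolyadicEquation (tTransp i i (.var 0), .var 0)
  | p8 (i j : Fin n) : IsPolyadicEquation
      (tTransp i j (tMeet (.var 0) (tDiag i j)), tMeet (.var 0) (tDiag i j))

lemma polyadicEquations_iff (A : Alg.{u} (polyLang n)) :
    PolyadicEquations A ↔ ∀ e, IsPolyadicEquation e → TrueIn A e := by
  constructor
  · rintro h e (_ | _ | _ | _ | _ | _ | _ | _) v <;> simp
    exacts [h.p1 .., h.p2 .., h.p3 .., h.p4 .., h.p5 .., h.p6 .., h.p7 .., h.p8 ..]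
  · intro h
    refine ⟨fun i j x y => ?_, fun i j x => ?_, fun i j k x => ?_, fun i j k l => ?_,
      fun i j k l x => ?_, fun i j x => ?_, fun i x => ?_, fun i j x => ?_⟩
    · simpa using h _ (.p1 i j) (fun k => if k = 0 then x else y)
    · simpa using h _ (.p2 i j) (fun _ => x)
    · simpa using h _ (.p3 i j k) (fun _ => x)
    · simpa using h _ (.p4 i j k l) (fun _ => diag i j)
    · simpa using h _ (.p5 i j k l) (fun _ => x)
    · simpa using h _ (.p6 i j) (fun _ => x)
    · simpa using h _ (.p7 i) (fun _ => x)
    · simpa using h _ (.p8 i j) (fun _ => x)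

/-- An equation of cylindric-type algebras, read in polyadic-type algebras. -/
def liftEquation (e : Equation (cylLang n)) : Equation (polyLang n) :=
  ((Language.LHom.sumInl : cylLang n →ᴸ polyLang n).onTerm e.1,
    (Language.LHom.sumInl : cylLang n →ᴸ polyLang n).onTerm e.2)

lemma trueIn_liftEquation (A : Alg.{u} (polyLang n)) (e : Equation (cylLang n)) :
    TrueIn A (liftEquation e) ↔ TrueIn (cylReduct A) e := by
  let : (cylLang n).Structure A :=
    (Language.LHom.sumInl : cylLang n →ᴸ polyLang n).reduct A
  have : (Language.LHom.sumInl : cylLang n →ᴸ polyLang n).IsExpansionOn A :=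
    Language.LHom.isExpansionOn_reduct _ _
  refine forall_congr' fun v => ?_
  simp only [liftEquation, Language.LHom.realize_onTerm]
  rfl

/-- An axiom system of `RCPEA`. -/
def rcpeaAxioms (n : ℕ) : Set (Equation (polyLang n)) :=
  liftEquation '' eqTheory (Cs.{u} n) ∪ {e | IsPolyadicEquation e}

/-- Representability of the reduct is equational in the larger signature too, so further equations
can be added to cut out varieties inside `RCPEA`. -/
lemma rcpea_eq_models : RCPEA.{u} n = models (rcpeaAxioms.{u} n) := by
  ext A
  simp only [RCPEA, RCA, models, rcpeaAxioms, Set.mem_ofPred_eq, polyadicEquations_iff,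
    Set.mem_union, or_imp, forall_and, Set.forall_mem_image, trueIn_liftEquation]

lemma mem_setCyl {U : Type u} {i : Fin n} {X : Set (Fin n → U)} {s : Fin n → U} :
    s ∈ setCyl i X ↔ ∃ t ∈ X, ∀ j, j ≠ i → s j = t j := Iff.rfl

lemma mem_setTransp {U : Type u} {i j : Fin n} {X : Set (Fin n → U)} {s : Fin n → U} :
    s ∈ setTransp i j X ↔ s ∘ Equiv.swap i j ∈ X := by
  constructor
  · rintro ⟨t, ht, h1, h2, h3⟩
    convert ht
    funext k
    simp only [Function.comp, Equiv.swap_apply_def]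
    grind
  · intro h
    refine ⟨_, h, by simp, by simp, fun l hi hj => ?_⟩
    simp [Equiv.swap_apply_of_ne_of_ne hi hj]

lemma cylReduct_mem_cs {A : Alg.{u} (polyLang n)} (hA : A ∈ Pse.{u} n) :
    cylReduct A ∈ Cs.{u} n := by
  obtain ⟨U, S, rfl⟩ := hA
  exact ⟨U, ⟨S.carrier, fun f => S.fun_mem (Sum.inl f)⟩, rfl⟩

lemma polyadicEquations_of_mem_pse {A : Alg.{u} (polyLang n)} (hA : A ∈ Pse.{u} n) :
    PolyadicEquations A := by
  obtain ⟨U, S, rfl⟩ := hA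
  refine ⟨fun i j x y => Subtype.ext ?_, fun i j x => Subtype.ext ?_,
    fun i j k x => Subtype.ext ?_, fun i j k l => Subtype.ext ?_,
    fun i j k l x => Subtype.ext ?_, fun i j x => Subtype.ext ?_, fun i x => Subtype.ext ?_,
    fun i j x => Subtype.ext ?_⟩
  · change setTransp i j (x.1 ∪ y.1) = setTransp i j x.1 ∪ setTransp i j y.1
    ext s; simp [mem_setTransp]
  · change setTransp i j (x.1)ᶜ = (setTransp i j x.1)ᶜ
    ext s; simp [mem_setTransp]
  · change setTransp i j (setCyl k x.1) = setCyl (Equiv.swap i j k) (setTransp i j x.1)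
    ext s
    simp only [mem_setTransp, mem_setCyl]
    constructor
    · rintro ⟨t, ht, h⟩
      refine ⟨t ∘ Equiv.swap i j, by simpa [Function.comp_def] using ht, fun l hl => ?_⟩
      have := h (Equiv.swap i j l) (fun e => hl (by rw [← e]; simp))
      simpa using this
    · rintro ⟨t, ht, h⟩
      refine ⟨_, ht, fun l hl => ?_⟩
      exact h _ (fun e => hl ((Equiv.swap i j).injective e))
  · change setTransp i j (setDiag U k l) = setDiag U (Equiv.swap i j k) (Equiv.swap i j l)
    ext s; simp [mem_setTransp, setDiag]
  · change setTransp i j (setTransp k l x.1) =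
      setTransp (Equiv.swap i j k) (Equiv.swap i j l) (setTransp i j x.1)
    ext s
    simp only [mem_setTransp]
    have : (s ∘ Equiv.swap i j) ∘ Equiv.swap k l =
        (s ∘ Equiv.swap (Equiv.swap i j k) (Equiv.swap i j l)) ∘ Equiv.swap i j := by
      funext m
      simp only [Function.comp]
      rw [Equiv.swap_apply_apply]
      simp
    rw [this]
  · change setTransp i j (setTransp i j x.1) = x.1
    ext s; simp [mem_setTransp, Function.comp_def]
  · change setTransp i i x.1 = x.1
    ext s; simp [mem_setTransp]
  · change setTransp i j ((x.1)ᶜ ∪ (setDiag U i j)ᶜ)ᶜ = ((x.1)ᶜ ∪ (setDiag U i j)ᶜ)ᶜ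
    ext s
    simp only [mem_setTransp, setDiag, Set.compl_union, compl_compl, Set.mem_inter_iff,
      Set.mem_ofPred_eq, Function.comp, Equiv.swap_apply_left, Equiv.swap_apply_right]
    constructor
    · rintro ⟨h1, h2⟩
      refine ⟨?_, h2.symm⟩
      convert h1 using 1
      funext k
      rw [Function.comp, Equiv.swap_apply_def]; grind
    · rintro ⟨h1, h2⟩
      refine ⟨?_, h2.symm⟩
      convert h1 using 1
      funext k
      rw [Function.comp, Equiv.swap_apply_def]; grind

lemma pse_subset_rcpea : Pse.{u} n ⊆ RCPEA.{u} n := fun _ hA =>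
  ⟨fun _ he => he _ (cylReduct_mem_cs hA), polyadicEquations_of_mem_pse hA⟩

lemma rcpeaAxioms_subset : rcpeaAxioms.{u} n ⊆ eqTheory (Pse.{u} n) := fun e he A hA => by
  have := pse_subset_rcpea hA
  rw [rcpea_eq_models] at this
  exact this e he

end Variety

/-! ### The equation omitting a finite algebra -/

section Omit

variable {n : ℕ}

/-- `ι` embeds the cylindric reduct of `B` into the full cylindric set algebra over `V`. -/
structure IsCylRep {B : Alg.{u} (polyLang n)} {V : Type u} (ι : B → Set (Fin n → V)) : Prop where
  inj : Function.Injective ι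
  add : ∀ x y, ι (add x y) = ι x ∪ ι y
  neg : ∀ x, ι (neg x) = (ι x)ᶜ
  cyl : ∀ i x, ι (cyl i x) = setCyl i (ι x)
  diag : ∀ i j, ι (diag i j) = setDiag V i j

/-- `h` is a homomorphism of polyadic-type algebras. -/
structure IsPolyHom {A B : Alg.{u} (polyLang n)} (h : A → B) : Prop where
  add : ∀ x y, h (add x y) = add (h x) (h y)
  neg : ∀ x, h (neg x) = neg (h x)
  cyl : ∀ i x, h (cyl i x) = cyl i (h x)
  diag : ∀ i j, h (diag i j) = diag i j
  transp : ∀ i j x, h (transp i j x) = transp i j (h x)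

lemma isPolyHom_id (A : Alg.{u} (polyLang n)) : IsPolyHom (id : A → A) := by
  constructor <;> intros <;> rfl

/-- The cylindrification along a list of coordinates. -/
def cylList {V : Type u} (l : List (Fin n)) (X : Set (Fin n → V)) : Set (Fin n → V) :=
  l.foldr setCyl X

lemma mem_cylList {V : Type u} {X : Set (Fin n → V)} (l : List (Fin n)) (s : Fin n → V) :
    s ∈ cylList l X ↔ ∃ t ∈ X, ∀ k ∉ l, s k = t k := by
  induction l generalizing s with
  | nil =>
    simp only [cylList, List.foldr_nil, List.not_mem_nil, not_false_eq_true, forall_const]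
    exact ⟨fun h => ⟨s, h, fun _ => rfl⟩, fun ⟨t, ht, h⟩ => by rwa [funext h]⟩
  | cons i l ih =>
    change s ∈ setCyl i (cylList l X) ↔ _
    constructor
    · rintro ⟨t, ht, h⟩
      obtain ⟨r, hr, h'⟩ := (ih t).1 ht
      refine ⟨r, hr, fun k hk => ?_⟩
      rw [List.mem_cons, not_or] at hk
      rw [h k hk.1, h' k hk.2]
    · rintro ⟨t, ht, h⟩
      refine ⟨fun k => if k = i then t i else s k, (ih _).2 ⟨t, ht, fun k hk => ?_⟩,
        fun k hk => by simp [hk]⟩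
      by_cases hki : k = i
      · simp [hki]
      · simpa [hki] using h k (by simp [hki, hk])

/-- Together with `cylList_empty` this makes full cylindrification a test for nonemptiness, so
negated equations become equations. -/
lemma cylList_finRange {V : Type u} {X : Set (Fin n → V)} (h : X.Nonempty) :
    cylList (List.finRange n) X = Set.univ := by
  obtain ⟨t, ht⟩ := h
  exact Set.eq_univ_of_forall fun s => (mem_cylList _ s).2 ⟨t, ht, by simp⟩

lemma cylList_empty {V : Type u} (l : List (Fin n)) :
    cylList l (∅ : Set (Fin n → V)) = ∅ := by
  ext s; simp [mem_cylList]

/-- The term is the union of the symmetric differences of the two sides; injectivity of `ι` turns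
its vanishing into equality. -/
lemma exists_term_eq_empty_iff (E : Set (Equation (polyLang n))) (hE : E.Finite) :
    ∃ d : (polyLang n).Term ℕ, ∀ (B : Alg.{u} (polyLang n)) (V : Type u)
      (ι : B → Set (Fin n → V)), IsCylRep ι → ∀ v : ℕ → B,
        (ι (d.realize v) = ∅ ↔ ∀ e ∈ E, e.1.realize v = e.2.realize v) := by
  induction E, hE using Set.Finite.induction_on with
  | empty =>
    refine ⟨tMeet (.var 0) (tNeg (.var 0)), fun B V ι h v => ?_⟩
    simp [meet, h.add, h.neg]
  | @insert e E _ _ ih =>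
    obtain ⟨d, hd⟩ := ih
    refine ⟨tAdd (tAdd (tMeet e.1 (tNeg e.2)) (tMeet e.2 (tNeg e.1))) d, fun B V ι h v => ?_⟩
    simp only [realize_tAdd, realize_tMeet, realize_tNeg, h.add, Set.union_empty_iff,
      hd B V ι h v, Set.forall_mem_insert, meet, h.neg, Set.compl_union, compl_compl]
    refine and_congr_left fun _ => ?_
    rw [← Set.sdiff_eq, ← Set.sdiff_eq, Set.sdiff_eq_empty, Set.sdiff_eq_empty,
      ← Set.Subset.antisymm_iff, h.inj.eq_iff]

lemma IsCylRep.realize_foldr {B : Alg.{u} (polyLang n)} {V : Type u} {ι : B → Set (Fin n → V)}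
    (h : IsCylRep ι) (v : ℕ → B) (d : (polyLang n).Term ℕ) (l : List (Fin n)) :
    ι ((l.foldr tCyl d).realize v) = cylList l (ι (d.realize v)) := by
  induction l with
  | nil => rfl
  | cons i l ih => simp only [List.foldr_cons, realize_tCyl, h.cyl, ih]; rfl

/-- For every finite algebra `A` there is an equation that is true in a cylindric set algebra with
additional transpositions if and only if `A` has no homomorphism into it. -/
theorem exists_equation_trueIn_iff (A : Alg.{u} (polyLang n)) [Finite A]
    [Nonempty A] : ∃ e : Equation (polyLang n), ∀ (B : Alg.{u} (polyLang n)) (V : Type u) [Nonempty V]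
      (ι : B → Set (Fin n → V)), IsCylRep ι → (TrueIn B e ↔ ∀ h : A → B, ¬ IsPolyHom h) := by
  obtain ⟨enc, henc⟩ : ∃ f : A → ℕ, Function.Injective f := by
    obtain ⟨m, ⟨f⟩⟩ := Finite.exists_equiv_fin A
    exact ⟨fun a => f a, Fin.val_injective.comp f.injective⟩
  -- Each element of `A` gets a variable of its own, and `E` lists the operation tables of `A`.
  let x : A → (polyLang n).Term ℕ := fun a => .var (enc a)
  let E : Set (Equation (polyLang n)) :=
    Set.range (fun p : A × A => (x (add p.1 p.2), tAdd (x p.1) (x p.2))) ∪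
    (Set.range (fun a : A => (x (neg a), tNeg (x a))) ∪
    (Set.range (fun p : Fin n × A => (x (cyl p.1 p.2), tCyl p.1 (x p.2))) ∪
    (Set.range (fun p : Fin n × Fin n => (x (diag p.1 p.2), tDiag p.1 p.2)) ∪
    Set.range (fun p : Fin n × Fin n × A =>
      (x (transp p.1 p.2.1 p.2.2), tTransp p.1 p.2.1 (x p.2.2))))))
  have hE : E.Finite := by
    refine (Set.finite_range _).union ((Set.finite_range _).union ((Set.finite_range _).union
      ((Set.finite_range _).union (Set.finite_range _))))
  have key : ∀ (B : Alg.{u} (polyLang n)) (v : ℕ → B),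
      (∀ e ∈ E, e.1.realize v = e.2.realize v) ↔ IsPolyHom (fun a => v (enc a)) := by
    intro B v
    simp only [E, Set.mem_union, or_imp, forall_and, Set.forall_mem_range, realize_tAdd,
      realize_tNeg, realize_tCyl, realize_tDiag, realize_tTransp, x, Language.Term.realize_var,
      Prod.forall]
    exact ⟨fun ⟨h1, h2, h3, h4, h5⟩ => ⟨h1, h2, h3, h4, h5⟩,
      fun h => ⟨h.add, h.neg, h.cyl, h.diag, h.transp⟩⟩
  obtain ⟨d, hd⟩ := exists_term_eq_empty_iff E hE
  -- The equation says that `d`, cylindrified in all coordinates, is 1: every evaluation violates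
  -- some entry of the tables.
  refine ⟨((List.finRange n).foldr tCyl d, tAdd (.var 0) (tNeg (.var 0))),
    fun B V _ ι hι => ?_⟩
  have hval : ∀ v : ℕ → B, ((List.finRange n).foldr tCyl d).realize v =
      (tAdd (n := n) (.var 0) (tNeg (.var 0))).realize v ↔ ¬ IsPolyHom (fun a => v (enc a)) := by
    intro v
    rw [← key, ← hd B V ι hι v, ← hι.inj.eq_iff, hι.realize_foldr]
    simp only [realize_tAdd, realize_tNeg, hι.add, hι.neg, Set.union_compl_self]
    constructor
    · intro h h0
      rw [h0, cylList_empty] at h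
      exact Set.empty_ne_univ h
    · intro h
      exact cylList_finRange (Set.nonempty_iff_ne_empty.2 h)
  constructor
  · intro h g hg
    obtain ⟨a⟩ := ‹Nonempty A›
    -- Variables that name no element of `A` do not matter and get the value `g a`.
    refine (hval (Function.extend enc g fun _ => g a)).1 (h _) ?_
    simpa only [henc.extend_apply] using hg
  · intro h v
    exact (hval v).2 (h _)

end Omit

/-! ### Points, colours and twisted transpositions -/

/-- The base set: scalars, permutations of the scalars, and weights. -/
abbrev Point (n : ℕ) (F : Type u) [Field F] : Type u :=
  F ⊕ (Equiv.Perm F ⊕ (Fin n × Fˣ × F))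

section Points

variable {n : ℕ} {F : Type u} [Field F]

/-- The point `x` is a scalar. -/
def IsScalar (x : Point n F) : Prop := ∃ b, x = Sum.inl b

/-- The point `x` is a permutation. -/
def IsPerm (x : Point n F) : Prop := ∃ d, x = Sum.inr (Sum.inl d)

/-- The point `y` is a permutation mapping the scalar `x` to `c`. -/
def Maps (c : F) (x y : Point n F) : Prop :=
  ∃ (b : F) (d : Equiv.Perm F), x = Sum.inl b ∧ y = Sum.inr (Sum.inl d) ∧ d b = c

/-- The value of a scalar. -/
def value : Point n F → F
  | Sum.inl b => b
  | Sum.inr _ => 0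

/-- The contribution of a weight to the colour. -/
def weight : Point n F → Fˣ
  | Sum.inr (Sum.inr w) => w.2.1
  | _ => 1

/-- Permutations of the base set that preserve the sorts and the relations `Maps c`. -/
def auts (n : ℕ) (F : Type u) [Field F] : Subgroup (Equiv.Perm (Point n F)) where
  carrier := {g | (∀ x, IsScalar (g x) ↔ IsScalar x) ∧ (∀ x, IsPerm (g x) ↔ IsPerm x) ∧
    ∀ c x y, Maps c (g x) (g y) ↔ Maps c x y}
  one_mem' := by simp
  mul_mem' := by
    rintro g h ⟨hg1, hg2, hg3⟩ ⟨hh1, hh2, hh3⟩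
    exact ⟨fun x => (hg1 _).trans (hh1 x), fun x => (hg2 _).trans (hh2 x),
      fun c x y => (hg3 c _ _).trans (hh3 c x y)⟩
  inv_mem' := by
    rintro g ⟨hg1, hg2, hg3⟩
    refine ⟨fun x => ?_, fun x => ?_, fun c x y => ?_⟩
    · rw [← hg1]; simp
    · rw [← hg2]; simp
    · rw [← hg3]; simp

/-- The automorphism given by permutations of the scalars and of the weights. -/
def autOf (g : Equiv.Perm F) (h : Equiv.Perm (Fin n × Fˣ × F)) : Equiv.Perm (Point n F) :=
  Equiv.sumCongr g (Equiv.sumCongr (Equiv.mulRight g⁻¹) h)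

lemma autOf_mem (g : Equiv.Perm F) (h : Equiv.Perm (Fin n × Fˣ × F)) :
    autOf g h ∈ auts n F := by
  refine ⟨?_, ?_, ?_⟩
  · rintro (b | d | w) <;> simp [autOf, IsScalar]
  · rintro (b | d | w) <;> simp [autOf, IsPerm]
  -- Right multiplication by `g⁻¹` on permutations is what preserves `Maps c`: (d g⁻¹)(g b) = d b.
  · rintro c (b | d | w) (b' | d' | w') <;> simp [autOf, Maps]

/-- `s` is an injective tuple of scalars and weights, the scalars are at the coordinates `i < j`,
and `s` has the colour `c`. -/
structure HasColor (s : Fin n → Point n F) (i j : Fin n) (c : Fˣ) : Prop where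
  lt : i < j
  inj : Function.Injective s
  scalar : ∀ k, IsScalar (s k) ↔ k = i ∨ k = j
  not_perm : ∀ k, ¬ IsPerm (s k)
  color : (c : F) = (value (s j) - value (s i)) * (∏ k, weight (s k) : Fˣ)

/-- `s` has some colour. -/
def Colored (s : Fin n → Point n F) : Prop := ∃ i j c, HasColor s i j c

/-- `s` is a twisted image of the tuple `t`, with coordinates permuted by `σ`. -/
def Twisted (σ : Equiv.Perm (Fin n)) (s t : Fin n → Point n F) : Prop :=
  (∃ i j k l c, HasColor s i j c ∧ HasColor t k l c ∧
    ∀ m, IsScalar (s m) ↔ IsScalar (t (σ m))) ∨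
  ¬ Colored s ∧ ∃ g ∈ auts n F, ∀ m, s m = g (t (σ m))

lemma HasColor.unique {s : Fin n → Point n F} {i j k l : Fin n} {c d : Fˣ}
    (h : HasColor s i j c) (h' : HasColor s k l d) : i = k ∧ j = l ∧ c = d := by
  have h1 := h.lt
  have h2 := h'.lt
  have hi := (h'.scalar i).1 ((h.scalar i).2 (Or.inl rfl))
  have hj := (h'.scalar j).1 ((h.scalar j).2 (Or.inr rfl))
  have : i = k ∧ j = l := by
    rcases hi with rfl | rfl <;> rcases hj with rfl | rfl
    · exact absurd h1 (lt_irrefl _)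
    · exact ⟨rfl, rfl⟩
    · exact absurd h1 (lt_asymm h2)
    · exact absurd h1 (lt_irrefl _)
  obtain ⟨rfl, rfl⟩ := this
  exact ⟨rfl, rfl, Units.ext (h.color.trans h'.color.symm)⟩

/-- A tuple of the right shape has a colour. -/
lemma exists_hasColor {s : Fin n → Point n F} {i j : Fin n} (hij : i ≠ j)
    (hs : Function.Injective s) (h1 : ∀ k, IsScalar (s k) ↔ k = i ∨ k = j)
    (h2 : ∀ k, ¬ IsPerm (s k)) : Colored s := by
  wlog hlt : i < j generalizing i j
  · exact this hij.symm (fun k => (h1 k).trans or_comm) (lt_of_le_of_ne (not_lt.1 hlt) hij.symm)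
  obtain ⟨b, hb⟩ := (h1 i).2 (Or.inl rfl)
  obtain ⟨b', hb'⟩ := (h1 j).2 (Or.inr rfl)
  have hbb : b' - b ≠ 0 := by
    rw [sub_ne_zero]
    rintro rfl
    exact hij (hs (hb.trans hb'.symm))
  refine ⟨i, j, Units.mk0 (b' - b) hbb * ∏ k, weight (s k), hlt, hs, h1, h2, ?_⟩
  simp [hb, hb', value]

lemma colored_iff {s : Fin n → Point n F} : Colored s ↔ ∃ i j, i ≠ j ∧ Function.Injective s ∧
    (∀ k, IsScalar (s k) ↔ k = i ∨ k = j) ∧ ∀ k, ¬ IsPerm (s k) :=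
  ⟨fun ⟨i, j, _, h⟩ => ⟨i, j, h.lt.ne, h.inj, h.scalar, h.not_perm⟩,
    fun ⟨_, _, h, hs, h1, h2⟩ => exists_hasColor h hs h1 h2⟩

/-- Having a colour depends only on injectivity and sorts, which automorphisms respect; the colour
itself may change. -/
lemma Colored.of_aut {s t : Fin n → Point n F} (hs : Colored s) (σ : Equiv.Perm (Fin n))
    {g : Equiv.Perm (Point n F)} (hg : g ∈ auts n F) (h : ∀ m, s m = g (t (σ m))) :
    Colored t := by
  rw [colored_iff] at hs ⊢
  obtain ⟨i, j, hij, hs, h1, h2⟩ := hs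
  have ht : ∀ m, g (t m) = s (σ.symm m) := fun m => by rw [h]; simp
  refine ⟨σ i, σ j, σ.injective.ne hij, fun a b hab => ?_, fun k => ?_, fun k => ?_⟩
  · have := congrArg g hab
    rw [ht, ht] at this
    exact σ.symm.injective (hs this)
  · rw [← hg.1, ht, h1, Equiv.symm_apply_eq, Equiv.symm_apply_eq]
  · rw [← hg.2.1, ht]
    exact h2 _

lemma Colored.map_aut {t : Fin n → Point n F} (ht : Colored t) (σ : Equiv.Perm (Fin n))
    {g : Equiv.Perm (Point n F)} (hg : g ∈ auts n F) : Colored (fun m => g (t (σ m))) :=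
  ht.of_aut σ⁻¹ ((auts n F).inv_mem hg) fun m => by simp

/-- Any colour can be reached by changing one coordinate. -/
lemma HasColor.exists_update {s : Fin n → Point n F} {i j : Fin n} {c : Fˣ}
    (h : HasColor s i j c) (k : Fin n) (d : Fˣ) :
    ∃ t, HasColor t i j d ∧ (∀ l, l ≠ k → s l = t l) ∧ ∀ l, IsScalar (t l) ↔ IsScalar (s l) := by
  classical
  obtain ⟨b, hb⟩ := (h.scalar i).2 (Or.inl rfl)
  obtain ⟨b', hb'⟩ := (h.scalar j).2 (Or.inr rfl)
  have hij := h.lt.ne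
  -- it is enough to find a new value of the coordinate
  suffices H : ∃ x : Point n F, (IsScalar x ↔ IsScalar (s k)) ∧ ¬ IsPerm x ∧
      (∀ l, l ≠ k → s l ≠ x) ∧
      (d : F) = (value (Function.update s k x j) - value (Function.update s k x i)) *
        (weight x * ∏ l ∈ Finset.univ.erase k, weight (s l) : Fˣ) by
    obtain ⟨x, hx1, hx2, hx3, hx4⟩ := H
    have hsc : ∀ l, IsScalar (Function.update s k x l) ↔ IsScalar (s l) := by
      intro l
      by_cases hl : l = k
      · subst hl; simpa using hx1
      · simp [hl]
    refine ⟨Function.update s k x, ⟨h.lt, ?_, fun l => (hsc l).trans (h.scalar l), ?_, ?_⟩,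
      fun l hl => by simp [hl], hsc⟩
    · intro a a' haa
      by_cases ha : a = k <;> by_cases ha' : a' = k
      · rw [ha, ha']
      · subst ha; simp only [Function.update_self, Function.update_of_ne ha'] at haa
        exact absurd haa.symm (hx3 _ ha')
      · subst ha'; simp only [Function.update_self, Function.update_of_ne ha] at haa
        exact absurd haa (hx3 _ ha)
      · simp only [Function.update_of_ne ha', Function.update_of_ne ha] at haa
        exact h.inj haa
    · intro l
      by_cases hl : l = k
      · subst hl; simpa using hx2
      · simpa [hl] using h.not_perm l
    · rw [hx4, ← Finset.mul_prod_erase _ _ (Finset.mem_univ k)]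
      congr 3
      · simp
      · refine Finset.prod_congr rfl fun l hl => ?_
        rw [Function.update_of_ne (Finset.ne_of_mem_erase hl)]
  set C : Fˣ := ∏ l ∈ Finset.univ.erase k, weight (s l) with hC
  have hfresh : ∀ x : F, (∀ l, l ≠ k → IsScalar (s l) → s l ≠ Sum.inl x) →
      ∀ l, l ≠ k → s l ≠ Sum.inl x := fun x hx l hl e => hx l hl ⟨x, e⟩ e
  by_cases hki : k = i
  · subst hki
    -- The solution x of d = (b' - x) C; it differs from b' because d is a unit.
    refine ⟨Sum.inl (b' - d * (C : F)⁻¹), by simp [hb, IsScalar], by simp [IsPerm],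
      hfresh _ fun l hl hsl => ?_, ?_⟩
    · obtain rfl := ((h.scalar l).1 hsl).resolve_left hl
      rw [hb', Ne, Sum.inl.injEq, eq_comm, sub_eq_self]
      simp
    · rw [Function.update_self, Function.update_of_ne hij.symm, hb']
      simp [value, weight]
  by_cases hkj : k = j
  · subst hkj
    refine ⟨Sum.inl (b + d * (C : F)⁻¹), by simp [hb', IsScalar], by simp [IsPerm],
      hfresh _ fun l hl hsl => ?_, ?_⟩
    · obtain rfl := ((h.scalar l).1 hsl).resolve_right hl
      rw [hb]
      simp
    · rw [Function.update_self, Function.update_of_ne hij, hb]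
      simp [value, weight]
  · have hbb : b' - b ≠ 0 := by
      rw [sub_ne_zero]
      rintro rfl
      exact hij (h.inj (hb.trans hb'.symm))
    have hks : ¬ IsScalar (s k) := by rw [h.scalar]; tauto
    -- The required weight exists in `n` copies, and the coordinates other than `k` occupy at most
    -- `n - 1` of them.
    obtain ⟨m, hm⟩ : ∃ m : Fin n, ∀ l, l ≠ k → s l ≠
        Sum.inr (Sum.inr (m, d * (Units.mk0 _ hbb)⁻¹ * C⁻¹, 0)) := by
      by_contra! hcon
      choose f hf hf' using hcon
      have hinj : Function.Injective f := fun a a' haa => by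
        have := (hf' a).symm.trans ((congrArg s haa).trans (hf' a'))
        simpa using this
      obtain ⟨a, ha⟩ := Finite.surjective_of_injective hinj k
      exact hf a ha
    refine ⟨_, by simp [hks]; simp [IsScalar], by simp [IsPerm], hm, ?_⟩
    rw [Function.update_of_ne (Ne.symm hki), Function.update_of_ne (Ne.symm hkj), hb, hb']
    simp [value, weight]
    field_simp

/-- A permutation of a finite type extending a partial injection. -/
lemma exists_perm_extending {ι X : Type*} [Finite X] (p : ι → Prop) (f g : ι → X)
    (hf : ∀ a b, p a → p b → f a = f b → a = b) (hg : ∀ a b, p a → p b → g a = g b → a = b) :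
    ∃ e : Equiv.Perm X, ∀ a, p a → e (f a) = g a := by
  classical
  let f' : {a // p a} → X := fun a => f a
  let g' : {a // p a} → X := fun a => g a
  have hf' : Function.Injective f' := fun a b h => Subtype.ext (hf _ _ a.2 b.2 h)
  have hg' : Function.Injective g' := fun a b h => Subtype.ext (hg _ _ a.2 b.2 h)
  let e : {x // x ∈ Set.range f'} ≃ {x // x ∈ Set.range g'} :=
    (Equiv.ofInjective f' hf').symm.trans (Equiv.ofInjective g' hg')
  refine ⟨e.extendSubtype, fun a ha => ?_⟩
  rw [Equiv.extendSubtype_apply_of_mem e _ ⟨⟨a, ha⟩, rfl⟩]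
  have : (Equiv.ofInjective f' hf').symm ⟨f a, ⟨⟨a, ha⟩, rfl⟩⟩ = ⟨a, ha⟩ :=
    (Equiv.symm_apply_eq _).2 rfl
  exact congrArg (fun z => (Equiv.ofInjective g' hg' z : X)) this

/-- Injective partial tuples of scalars and weights with the same sorts are conjugate. -/
lemma exists_aut [Finite F] {p : Fin n → Prop} {s t : Fin n → Point n F}
    (hs : ∀ a b, p a → p b → s a = s b → a = b) (ht : ∀ a b, p a → p b → t a = t b → a = b)
    (hsp : ∀ k, p k → ¬ IsPerm (s k)) (htp : ∀ k, p k → ¬ IsPerm (t k))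
    (hst : ∀ k, p k → (IsScalar (s k) ↔ IsScalar (t k))) :
    ∃ g ∈ auts n F, ∀ k, p k → g (s k) = t k := by
  have hW : ∀ x : Point n F, ¬ IsPerm x → ¬ IsScalar x → ∃ w, x = Sum.inr (Sum.inr w) := by
    rintro (b | d | w) h1 h2
    exacts [absurd ⟨b, rfl⟩ h2, absurd ⟨d, rfl⟩ h1, ⟨w, rfl⟩]
  have h1 : ∀ k : {k // p k ∧ IsScalar (s k)}, ∃ b, s k = Sum.inl b := fun k => k.2.2
  have h2 : ∀ k : {k // p k ∧ IsScalar (s k)}, ∃ b, t k = Sum.inl b :=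
    fun k => (hst k k.2.1).1 k.2.2
  have h3 : ∀ k : {k // p k ∧ ¬ IsScalar (s k)}, ∃ w, s k = Sum.inr (Sum.inr w) :=
    fun k => hW _ (hsp k k.2.1) k.2.2
  have h4 : ∀ k : {k // p k ∧ ¬ IsScalar (s k)}, ∃ w, t k = Sum.inr (Sum.inr w) :=
    fun k => hW _ (htp k k.2.1) ((hst k k.2.1).not.1 k.2.2)
  choose f₁ hf₁ using h1
  choose g₁ hg₁ using h2
  choose f₂ hf₂ using h3
  choose g₂ hg₂ using h4
  obtain ⟨e₁, he₁⟩ := exists_perm_extending (fun _ => True) f₁ g₁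
    (fun a b _ _ h => Subtype.ext (hs _ _ a.2.1 b.2.1 (by rw [hf₁, hf₁, h])))
    (fun a b _ _ h => Subtype.ext (ht _ _ a.2.1 b.2.1 (by rw [hg₁, hg₁, h])))
  obtain ⟨e₂, he₂⟩ := exists_perm_extending (fun _ => True) f₂ g₂
    (fun a b _ _ h => Subtype.ext (hs _ _ a.2.1 b.2.1 (by rw [hf₂, hf₂, h])))
    (fun a b _ _ h => Subtype.ext (ht _ _ a.2.1 b.2.1 (by rw [hg₂, hg₂, h])))
  refine ⟨autOf e₁ e₂, autOf_mem _ _, fun k hk => ?_⟩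
  by_cases hsk : IsScalar (s k)
  · rw [hf₁ ⟨k, hk, hsk⟩, hg₁ ⟨k, hk, hsk⟩, ← he₁ _ trivial]
    rfl
  · rw [hf₂ ⟨k, hk, hsk⟩, hg₂ ⟨k, hk, hsk⟩, ← he₂ _ trivial]
    rfl

lemma Twisted.refl (s : Fin n → Point n F) : Twisted 1 s s := by
  by_cases hs : Colored s
  · obtain ⟨i, j, c, h⟩ := hs
    exact Or.inl ⟨i, j, i, j, c, h, h, fun _ => Iff.rfl⟩
  · exact Or.inr ⟨hs, 1, one_mem _, fun _ => rfl⟩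

lemma Twisted.symm {σ : Equiv.Perm (Fin n)} {s t : Fin n → Point n F} (h : Twisted σ s t) :
    Twisted σ⁻¹ t s := by
  rcases h with ⟨i, j, k, l, c, hs, ht, h⟩ | ⟨hs, g, hg, h⟩
  · exact Or.inl ⟨k, l, i, j, c, ht, hs, fun m => by rw [h]; simp⟩
  · refine Or.inr ⟨fun ht => hs ?_, g⁻¹, inv_mem hg, fun m => by rw [h]; simp⟩
    rw [funext h]
    exact ht.map_aut σ hg

lemma Twisted.colored_iff {σ : Equiv.Perm (Fin n)} {s t : Fin n → Point n F}
    (h : Twisted σ s t) : Colored s ↔ Colored t := by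
  rcases h with ⟨i, j, k, l, c, hs, ht, h⟩ | ⟨hs, g, hg, h⟩
  · exact ⟨fun _ => ⟨_, _, _, ht⟩, fun _ => ⟨_, _, _, hs⟩⟩
  · refine ⟨fun h => absurd h hs, fun ht => ?_⟩
    rw [funext h]
    exact ht.map_aut σ hg

lemma Twisted.trans {σ ρ : Equiv.Perm (Fin n)} {s t r : Fin n → Point n F}
    (h : Twisted σ s t) (h' : Twisted ρ t r) : Twisted (ρ * σ) s r := by
  have hc := h.colored_iff
  rcases h with ⟨i, j, k, l, c, hs, ht, h⟩ | ⟨hs, g, hg, h⟩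
  · rcases h' with ⟨i', j', k', l', c', hs', ht', h'⟩ | ⟨hs', _⟩
    · obtain ⟨-, -, rfl⟩ := ht.unique hs'
      exact Or.inl ⟨i, j, k', l', c, hs, ht', fun m => by rw [h, h']; rfl⟩
    · exact absurd ⟨_, _, _, ht⟩ hs'
  · rcases h' with ⟨i', j', k', l', c', hs', ht', h'⟩ | ⟨hs', g', hg', h'⟩
    · exact absurd (hc.2 ⟨_, _, _, hs'⟩) hs
    · exact Or.inr ⟨hs, g * g', mul_mem hg hg', fun m => by rw [h, h']; rfl⟩

/-- A coloured tuple is permuted and then recoloured, which undoes the effect of the permutation on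
the colour. -/
lemma exists_twisted (σ : Equiv.Perm (Fin n)) (s : Fin n → Point n F) : ∃ t, Twisted σ t s := by
  by_cases hs : Colored s
  · obtain ⟨i, j, c, h⟩ := hs
    obtain ⟨i', j', d, h'⟩ : Colored (fun m => s (σ m)) :=
      Colored.map_aut (g := 1) ⟨i, j, c, h⟩ σ (one_mem _)
    obtain ⟨t, ht, -, h2⟩ := h'.exists_update i c
    exact ⟨t, Or.inl ⟨_, _, _, _, c, ht, h, h2⟩⟩
  · refine ⟨fun m => s (σ m), Or.inr ⟨fun h => hs ?_, 1, one_mem _, fun _ => rfl⟩⟩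
    exact h.of_aut σ (one_mem _) fun m => rfl

lemma Twisted.eq_iff {σ : Equiv.Perm (Fin n)} {s t : Fin n → Point n F} (h : Twisted σ s t)
    (k l : Fin n) : s k = s l ↔ t (σ k) = t (σ l) := by
  rcases h with ⟨_, _, _, _, c, hs, ht, h⟩ | ⟨hs, g, hg, h⟩
  · rw [hs.inj.eq_iff, ht.inj.eq_iff, σ.injective.eq_iff]
  · rw [h, h, g.injective.eq_iff]

/-- The source of (P8): for `i ≠ j` a tuple with a repetition has no colour, so the twist does not
act on it, and exchanging equal entries does nothing. -/
lemma Twisted.of_eq {i j : Fin n} {s t : Fin n → Point n F} (h : Twisted (Equiv.swap i j) s t)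
    (hij : s i = s j) : Twisted 1 s t := by
  rcases eq_or_ne i j with rfl | hne
  · rwa [Equiv.swap_self] at h
  have ht := (h.eq_iff i j).1 hij
  rcases h with ⟨_, _, _, _, c, hs, -⟩ | ⟨hs, g, hg, h⟩
  · exact absurd (hs.inj hij) hne
  · refine Or.inr ⟨hs, g, hg, fun m => ?_⟩
    rw [h, Equiv.Perm.one_apply, Equiv.swap_apply_def]
    simp only [Equiv.swap_apply_left, Equiv.swap_apply_right] at ht
    grind

/-- Twisted images can be completed along cylindrifications. -/
lemma Twisted.amalgam [Finite F] {σ : Equiv.Perm (Fin n)} {s t r : Fin n → Point n F} {k : Fin n}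
    (h : Twisted σ s t) (hr : ∀ l, l ≠ k → t l = r l) :
    ∃ u, (∀ l, l ≠ σ⁻¹ k → s l = u l) ∧ Twisted σ u r := by
  have hne : ∀ {l}, l ≠ σ⁻¹ k → σ l ≠ k := fun {l} hl e => hl (by rw [← e]; simp)
  by_cases hrc : Colored r
  · obtain ⟨i, j, c, hrc⟩ := hrc
    -- it is enough to complete the tuple with some colour
    suffices H : ∃ u, (∀ l, l ≠ σ⁻¹ k → s l = u l) ∧ Colored u ∧
        ∀ m, IsScalar (u m) ↔ IsScalar (r (σ m)) by
      obtain ⟨u, hu, ⟨i', j', d, hd⟩, h2⟩ := H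
      obtain ⟨u', hc, h1, h3⟩ := hd.exists_update (σ⁻¹ k) c
      exact ⟨u', fun l hl => (hu l hl).trans (h1 l hl),
        Or.inl ⟨_, _, _, _, c, hc, hrc, fun m => (h3 m).trans (h2 m)⟩⟩
    rcases h with ⟨i₁, j₁, i₂, j₂, d, hs, ht, h⟩ | ⟨hs, g, hg, h⟩
    -- `t` and `r` agree off `k` and have exactly two scalars each, so their scalars sit at the same
    -- coordinates and `s` already has the right sorts.
    · refine ⟨s, fun _ _ => rfl, ⟨_, _, _, hs⟩, fun m => ?_⟩
      rw [h]
      have key : ∀ l, l ≠ k → ((l = i ∨ l = j) ↔ (l = i₂ ∨ l = j₂)) := fun l hl => by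
        rw [← hrc.scalar, ← ht.scalar, hr l hl]
      rw [ht.scalar, hrc.scalar]
      have h1 := hrc.lt
      have h2 := ht.lt
      have k1 := key i
      have k2 := key j
      have k3 := key i₂
      have k4 := key j₂
      grind
    · refine ⟨fun m => g (r (σ m)), fun l hl => ?_, ?_, fun m => hg.1 _⟩
      · rw [h, hr _ (hne hl)]
      · exact Colored.map_aut ⟨_, _, _, hrc⟩ σ hg
  -- If `t` is coloured, `s` and `t` share little beyond injectivity and sorts; after deleting a
  -- coordinate this is enough for an automorphism.
  · suffices H : ∃ g ∈ auts n F, ∀ l, l ≠ σ⁻¹ k → g (r (σ l)) = s l by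
      obtain ⟨g, hg, h1⟩ := H
      exact ⟨fun m => g (r (σ m)), fun l hl => (h1 l hl).symm,
        Or.inr ⟨fun hc => hrc (hc.of_aut σ hg fun _ => rfl), g, hg, fun _ => rfl⟩⟩
    rcases h with ⟨i₁, j₁, i₂, j₂, d, hs, ht, h⟩ | ⟨hs, g, hg, h⟩
    · refine exists_aut (p := fun l => l ≠ σ⁻¹ k) ?_ (fun a b _ _ e => hs.inj e) ?_
        (fun l _ => hs.not_perm l) ?_
      · intro a b ha hb e
        rw [← hr _ (hne ha), ← hr _ (hne hb)] at e
        exact σ.injective (ht.inj e)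
      · intro l hl
        rw [← hr _ (hne hl)]
        exact ht.not_perm _
      · intro l hl
        rw [← hr _ (hne hl), h]
    · exact ⟨g, hg, fun l hl => by rw [h, hr _ (hne hl)]⟩

end Points

/-! ### The algebras with twisted transpositions -/

section TwistedAlgebra

variable (n : ℕ) (F : Type u) [Field F] [Finite F]

/-- The cylindric set algebra of all sets of tuples that are closed under twisted images. -/
def twistedSets : (cylLang n).Substructure (Set (Fin n → Point n F)) where
  carrier := {X | ∀ s t, Twisted 1 s t → t ∈ X → s ∈ X}
  fun_mem := by
    rintro _ (_ | _ | i | ⟨i, j⟩) x hx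
    · rintro s t h (ht | ht)
      exacts [Or.inl (hx 0 s t h ht), Or.inr (hx 1 s t h ht)]
    · exact fun s t h ht hs => ht (hx 0 t s h.symm hs)
    · rintro s t h ⟨r, hr, htr⟩
      obtain ⟨u, hu, hur⟩ := h.amalgam htr
      exact ⟨u, hx 0 _ _ hur hr, hu⟩
    · exact fun s t h ht => (h.eq_iff i j).2 ht

/-- The twisted transposition. -/
def twistedTransp (i j : Fin n) (X : twistedSets n F) : twistedSets n F :=
  ⟨{s | ∃ t ∈ X.1, Twisted (Equiv.swap i j) s t}, by
    rintro s t h ⟨r, hr, htr⟩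
    exact ⟨r, hr, by simpa using h.trans htr⟩⟩

instance twistedTranspStructure : (transpLang n).Structure (twistedSets n F) where
  funMap
    | TranspFunc.transp i j, x => twistedTransp n F i j (x 0)
  RelMap r _ := r.elim

/-- The algebra of all sets closed under twisted images, with the twisted transpositions. -/
def twistedAlg : Alg.{u} (polyLang n) := ⟨twistedSets n F, inferInstance⟩

instance : Finite (twistedAlg n F) :=
  inferInstanceAs (Finite (twistedSets n F))

variable {n F}

/-- The inclusion of the twisted algebra in the full cylindric set algebra. -/
def twistedIncl (X : twistedAlg n F) : Set (Fin n → Point n F) := Subtype.val X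

lemma isCylRep_twistedIncl : IsCylRep (twistedIncl (n := n) (F := F)) where
  inj := Subtype.val_injective
  add _ _ := rfl
  neg _ := rfl
  cyl _ _ := rfl
  diag _ _ := rfl

instance : Nonempty (twistedAlg n F) := ⟨⟨Set.univ, fun _ _ _ _ => trivial⟩⟩

lemma twistedIncl_closed (X : twistedAlg n F) {s t : Fin n → Point n F} (h : Twisted 1 s t)
    (ht : t ∈ twistedIncl X) : s ∈ twistedIncl X := X.2 s t h ht

lemma mem_twistedIncl_transp {i j : Fin n} {X : twistedAlg n F} {s t : Fin n → Point n F}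
    (h : Twisted (Equiv.swap i j) s t) : s ∈ twistedIncl (transp i j X) ↔ t ∈ twistedIncl X := by
  constructor
  · rintro ⟨r, hr, hsr⟩
    exact twistedIncl_closed X (by simpa using h.symm.trans hsr) hr
  · exact fun ht => ⟨t, ht, h⟩

lemma cylReduct_twistedAlg_mem : cylReduct (twistedAlg n F) ∈ Cs.{u} n :=
  ⟨Point n F, twistedSets n F, rfl⟩

lemma polyadicEquations_twistedAlg : PolyadicEquations (twistedAlg n F) := by
  have ι := isCylRep_twistedIncl (n := n) (F := F)
  -- membership in a transposed set is decided by any twisted image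
  have htr : ∀ (i j : Fin n) (s : Fin n → Point n F), ∃ t, Twisted (Equiv.swap i j) s t := by
    intro i j s
    obtain ⟨t, ht⟩ := exists_twisted (Equiv.swap i j) s
    exact ⟨t, by simpa using ht.symm⟩
  have hsymm : ∀ {i j : Fin n} {s t : Fin n → Point n F}, Twisted (Equiv.swap i j) s t →
    Twisted (Equiv.swap i j) t s := fun h => by simpa using h.symm
  refine ⟨fun i j x y => ι.inj (Set.ext fun s => ?_), fun i j x => ι.inj (Set.ext fun s => ?_),
    fun i j k x => ι.inj (Set.ext fun s => ?_), fun i j k l => ι.inj (Set.ext fun s => ?_),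
    fun i j k l x => ι.inj (Set.ext fun s => ?_), fun i j x => ι.inj (Set.ext fun s => ?_),
    fun i x => ι.inj (Set.ext fun s => ?_), fun i j x => ι.inj (Set.ext fun s => ?_)⟩
  · obtain ⟨t, h⟩ := htr i j s
    simp only [ι.add, Set.mem_union, mem_twistedIncl_transp h]
  · obtain ⟨t, h⟩ := htr i j s
    simp only [ι.neg, Set.mem_compl_iff, mem_twistedIncl_transp h]
  · obtain ⟨t, h⟩ := htr i j s
    rw [mem_twistedIncl_transp h, ι.cyl, ι.cyl, mem_setCyl, mem_setCyl]
    constructor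
    · rintro ⟨r, hr, htr⟩
      obtain ⟨u, hu, hur⟩ := h.amalgam htr
      exact ⟨u, (mem_twistedIncl_transp hur).2 hr, by simpa using hu⟩
    · rintro ⟨u, hu, hsu⟩
      obtain ⟨r, hr, hru⟩ := (hsymm h).amalgam hsu
      exact ⟨r, (mem_twistedIncl_transp (hsymm hru)).1 hu, by simpa using hr⟩
  · obtain ⟨t, h⟩ := htr i j s
    rw [mem_twistedIncl_transp h, ι.diag, ι.diag]
    exact (hsymm h).eq_iff k l
  · obtain ⟨t, h⟩ := htr i j s
    obtain ⟨r, h'⟩ := htr k l t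
    obtain ⟨t', h₁⟩ := htr (Equiv.swap i j k) (Equiv.swap i j l) s
    obtain ⟨r', h₁'⟩ := htr i j t'
    rw [mem_twistedIncl_transp h, mem_twistedIncl_transp h', mem_twistedIncl_transp h₁,
      mem_twistedIncl_transp h₁']
    -- Both sides of (P5) permute the coordinates in the same way, so `r` and `r'` lie in the same
    -- elements of the algebra.
    have key := (h.trans h').symm.trans (h₁.trans h₁')
    have e : (Equiv.swap i j * Equiv.swap (Equiv.swap i j k) (Equiv.swap i j l)) *
        (Equiv.swap k l * Equiv.swap i j)⁻¹ = 1 := by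
      rw [Equiv.swap_apply_apply, mul_inv_eq_one, ← mul_assoc, ← mul_assoc]
      simp
    rw [e] at key
    exact ⟨twistedIncl_closed x (by simpa using key.symm), twistedIncl_closed x key⟩
  · obtain ⟨t, h⟩ := htr i j s
    rw [mem_twistedIncl_transp h, mem_twistedIncl_transp (hsymm h)]
  · rw [mem_twistedIncl_transp (t := s)]
    rw [Equiv.swap_self]
    exact Twisted.refl s
  · obtain ⟨t, h⟩ := htr i j s
    rw [mem_twistedIncl_transp h]
    simp only [meet, ι.neg, ι.add, ι.diag, Set.compl_union, compl_compl, Set.mem_inter_iff]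
    constructor
    · rintro ⟨h1, h2⟩
      have := (hsymm h).of_eq h2
      exact ⟨twistedIncl_closed x (by simpa using this.symm) h1, ((h.eq_iff i j).2 (by
        simpa using Eq.symm h2))⟩
    · rintro ⟨h1, h2⟩
      have := h.of_eq h2
      exact ⟨twistedIncl_closed x (by simpa using this.symm) h1, (((hsymm h).eq_iff i j).2 (by
        simpa using Eq.symm h2))⟩

lemma twistedAlg_mem_rcpea : twistedAlg n F ∈ RCPEA.{u} n :=
  ⟨fun _ he => he _ cylReduct_twistedAlg_mem, polyadicEquations_twistedAlg⟩

end TwistedAlgebra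

/-! ### Maps into full cylindric set algebras -/

section CylMap

variable {n : ℕ}

/-- `φ` is a homomorphism from the cylindric reduct of `A` to the full cylindric set algebra
over `V`. -/
structure IsCylMap {A : Alg.{u} (polyLang n)} {V : Type u} (φ : A → Set (Fin n → V)) : Prop where
  add : ∀ x y, φ (add x y) = φ x ∪ φ y
  neg : ∀ x, φ (neg x) = (φ x)ᶜ
  cyl : ∀ i x, φ (cyl i x) = setCyl i (φ x)
  diag : ∀ i j, φ (diag i j) = setDiag V i j

variable {A B : Alg.{u} (polyLang n)} {U V : Type u} {ι : A → Set (Fin n → U)}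
  {φ : A → Set (Fin n → V)}

lemma IsCylRep.isCylMap (h : IsCylRep ι) : IsCylMap ι := ⟨h.add, h.neg, h.cyl, h.diag⟩

lemma IsCylRep.comp {κ : B → Set (Fin n → V)} (hκ : IsCylRep κ) {h : A → B} (hh : IsPolyHom h) :
    IsCylMap (fun a => κ (h a)) :=
  ⟨fun x y => by rw [hh.add, hκ.add], fun x => by rw [hh.neg, hκ.neg],
    fun i x => by rw [hh.cyl, hκ.cyl], fun i j => by rw [hh.diag, hκ.diag]⟩

lemma IsCylMap.meet (h : IsCylMap φ) (x y : A) : φ (meet x y) = φ x ∩ φ y := by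
  simp [PolyadicGap.meet, h.add, h.neg]

/-- Inclusion is the equation x + y = y, so inclusions checked on concrete tuples of `U` hold in
every cylindric image. -/
lemma IsCylMap.mono (h : IsCylMap φ) (hι : IsCylRep ι) {x y : A} (hxy : ι x ⊆ ι y) :
    φ x ⊆ φ y := by
  have : PolyadicGap.add x y = y := hι.inj (by rw [hι.add, Set.union_eq_right.2 hxy])
  rw [← Set.union_eq_right, ← h.add, this]

lemma IsCylMap.not_mem_of_disjoint (h : IsCylMap φ) (hι : IsCylRep ι) {x y : A}
    (hxy : ∀ s ∈ ι x, s ∉ ι y) {s : Fin n → V} (hs : s ∈ φ x) : s ∉ φ y := by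
  have := h.mono hι (x := x) (y := PolyadicGap.neg y) (by rw [hι.neg]; exact hxy)
  rw [h.neg] at this
  exact this hs

lemma IsCylMap.eq_univ (h : IsCylMap φ) (hι : IsCylRep ι) {x : A} (hx : ι x = Set.univ) :
    φ x = Set.univ := by
  have : PolyadicGap.add x (PolyadicGap.neg x) = x := hι.inj (by simp [hι.add, hx])
  rw [← this, h.add, h.neg, Set.union_compl_self]

lemma IsCylMap.foldr (h : IsCylMap φ) (l : List (Fin n)) (x : A) :
    φ (l.foldr PolyadicGap.cyl x) = cylList l (φ x) := by
  induction l with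
  | nil => rfl
  | cons i l ih => rw [List.foldr_cons, h.cyl, ih]; rfl

/-- Nonemptiness is equational as well: cylindrifying in all coordinates gives the unit. -/
lemma IsCylMap.nonempty [Nonempty V] (h : IsCylMap φ) (hι : IsCylRep ι) {x : A}
    (hx : (ι x).Nonempty) : (φ x).Nonempty := by
  have h1 := h.eq_univ hι (x := (List.finRange n).foldr PolyadicGap.cyl x)
    (by rw [hι.isCylMap.foldr, cylList_finRange hx])
  rw [h.foldr] at h1
  by_contra h2
  rw [Set.not_nonempty_iff_eq_empty] at h2
  rw [h2, cylList_empty] at h1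
  exact Set.empty_ne_univ h1

lemma IsCylMap.subset_iUnion (h : IsCylMap φ) (hι : IsCylRep ι) {J : Type*} [Finite J] {x : A}
    {y : J → A} (hxy : ι x ⊆ ⋃ j, ι (y j)) : φ x ⊆ ⋃ j, φ (y j) := by
  have key : ∀ S : Set J, S.Finite →
      ∃ z : A, ι z = ⋃ j ∈ S, ι (y j) ∧ φ z = ⋃ j ∈ S, φ (y j) := by
    intro S hS
    induction S, hS using Set.Finite.induction_on with
    | empty =>
      exact ⟨PolyadicGap.meet x (PolyadicGap.neg x), by simp [hι.isCylMap.meet, hι.neg],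
        by simp [h.meet, h.neg]⟩
    | @insert j S _ _ ih =>
      obtain ⟨z, h1, h2⟩ := ih
      exact ⟨PolyadicGap.add (y j) z, by rw [hι.add, h1, Set.biUnion_insert],
        by rw [h.add, h2, Set.biUnion_insert]⟩
  obtain ⟨z, h1, h2⟩ := key Set.univ Set.finite_univ
  rw [Set.biUnion_univ] at h1 h2
  rw [← h2]
  exact h.mono hι (h1 ▸ hxy)

/-- The set `X` depends only on the coordinates satisfying `p`. -/
def DependsOn (p : Fin n → Prop) (X : Set (Fin n → V)) : Prop :=
  ∀ s t, (∀ k, p k → s k = t k) → s ∈ X → t ∈ X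

/-- The irrelevant coordinates are finitely many and can be changed one at a time. In this form the
property is a set of inclusions and passes to cylindric images. -/
lemma dependsOn_of_setCyl_subset {p : Fin n → Prop} {X : Set (Fin n → V)}
    (h : ∀ k, ¬ p k → setCyl k X ⊆ X) : DependsOn p X := by
  classical
  intro s t hst hs
  have key : ∀ l : List (Fin n), (∀ k ∈ l, ¬ p k) → cylList l X ⊆ X := by
    intro l
    induction l with
    | nil => exact fun _ => subset_rfl
    | cons i l ih =>
      rintro hl r ⟨q, hq, hrq⟩
      exact h i (hl i (by simp)) ⟨q, ih (fun k hk => hl k (by simp [hk])) hq, hrq⟩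
  refine key ((List.finRange n).filter fun k => ¬ p k) (by simp)
    ((mem_cylList _ _).2 ⟨s, hs, fun k hk => (hst k ?_).symm⟩)
  simpa using hk

lemma IsCylMap.dependsOn (h : IsCylMap φ) (hι : IsCylRep ι) {p : Fin n → Prop} {x : A}
    (hx : DependsOn p (ι x)) : DependsOn p (φ x) := by
  refine dependsOn_of_setCyl_subset fun k hk => ?_
  rw [← h.cyl]
  refine h.mono hι ?_
  rw [hι.cyl]
  rintro s ⟨t, ht, hst⟩
  exact hx t s (fun l hl => (hst l (by rintro rfl; exact hk hl)).symm) ht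

end CylMap

/-! ### The number of scalars is determined by the cylindric reduct -/

section Scalars

variable {n : ℕ} {F : Type u} [Field F] [Finite F] {V : Type u}

/-- The tuples beginning with a scalar. -/
def scalarElem : twistedAlg (n + 3) F := ⟨{s | IsScalar (s 0)}, by
  rintro s t (⟨_, _, _, _, _, _, _, h⟩ | ⟨-, g, hg, h⟩) ht
  · exact (h 0).2 ht
  · change IsScalar (s 0)
    rw [h]
    exact (hg.1 _).2 ht⟩

/-- The tuples with a permutation at the coordinate `1`. -/
def permElem : twistedAlg (n + 3) F := ⟨{s | IsPerm (s 1)}, by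
  rintro s t (⟨_, _, _, _, _, _, h, -⟩ | ⟨-, g, hg, h⟩) ht
  · exact absurd ht (h.not_perm 1)
  · change IsPerm (s 1)
    rw [h]
    exact (hg.2.1 _).2 ht⟩

/-- The tuples whose entry `1` is a permutation mapping the scalar at `0` to `c`. -/
def mapsElem (c : F) : twistedAlg (n + 3) F := ⟨{s | Maps c (s 0) (s 1)}, by
  rintro s t (⟨_, _, _, _, _, _, h, -⟩ | ⟨-, g, hg, h⟩) ht
  · obtain ⟨_, d, -, hd, -⟩ := ht
    exact absurd ⟨d, hd⟩ (h.not_perm 1)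
  · change Maps c (s 0) (s 1)
    rw [h, h]
    exact (hg.2.2 _ _ _).2 ht⟩

/-- The tuples with scalars at the first two coordinates and with colour `c`. -/
def colorElem (c : Fˣ) : twistedAlg (n + 3) F := ⟨{s | HasColor s 0 1 c}, by
  rintro s t h ht
  rcases h with ⟨i, j, k, l, d, hs, ht', h⟩ | ⟨hs, h⟩
  · obtain ⟨rfl, rfl, rfl⟩ := ht.unique ht'
    have : ∀ m, (m = i ∨ m = j) ↔ (m = 0 ∨ m = 1) := fun m => by
      rw [← hs.scalar, h, ht.scalar]; rfl
    have h1 := hs.lt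
    have h2 := ht.lt
    have k1 := this i
    have k2 := this j
    have k3 := this 0
    have k4 := this 1
    have : i = 0 ∧ j = 1 := by grind
    obtain ⟨rfl, rfl⟩ := this
    exact hs
  · exact absurd ((Twisted.colored_iff (Or.inr ⟨hs, h⟩)).2 ⟨_, _, _, ht⟩) hs⟩

@[simp] lemma mem_scalarElem {s : Fin (n + 3) → Point (n + 3) F} :
    s ∈ twistedIncl scalarElem ↔ IsScalar (s 0) := Iff.rfl

@[simp] lemma mem_permElem {s : Fin (n + 3) → Point (n + 3) F} :
    s ∈ twistedIncl permElem ↔ IsPerm (s 1) := Iff.rfl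

@[simp] lemma mem_mapsElem {c : F} {s : Fin (n + 3) → Point (n + 3) F} :
    s ∈ twistedIncl (mapsElem c) ↔ Maps c (s 0) (s 1) := Iff.rfl

@[simp] lemma mem_colorElem {c : Fˣ} {s : Fin (n + 3) → Point (n + 3) F} :
    s ∈ twistedIncl (colorElem c) ↔ HasColor s 0 1 c := Iff.rfl

/-- In every cylindric image of the twisted algebra, the scalars are enumerated by `F`. -/
theorem exists_scalars_eq_range [Nonempty V] {φ : twistedAlg (n + 3) F → Set (Fin (n + 3) → V)}
    (hφ : IsCylMap φ) : ∃ g : F → V, Function.Injective g ∧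
      ∀ s, s ∈ φ scalarElem ↔ s 0 ∈ Set.range g := by
  have ι := isCylRep_twistedIncl (n := n + 3) (F := F)
  have h01 : (0 : Fin (n + 3)) ≠ 1 := by simp
  have h02 : (0 : Fin (n + 3)) ≠ 2 := by
    rw [Ne, Fin.ext_iff, Fin.val_two]; simp
  have h12 : (1 : Fin (n + 3)) ≠ 2 := by
    rw [Ne, Fin.ext_iff, Fin.val_two]; simp
  have dS : DependsOn (· = 0) (φ scalarElem) := hφ.dependsOn ι fun s t h hs => by
    simpa [← h 0 rfl] using hs
  have dP : DependsOn (· = 1) (φ permElem) := hφ.dependsOn ι fun s t h hs => by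
    simpa [← h 1 rfl] using hs
  have dM : ∀ c, DependsOn (fun k => k = 0 ∨ k = 1) (φ (mapsElem c)) := fun c =>
    hφ.dependsOn ι fun s t h hs => by
      simpa [← h 1 (Or.inr rfl), ← h 0 (Or.inl rfl)] using hs
  -- The abstract permutation at coordinate 1 of `t` is fixed from here on; `g c` will be the scalar
  -- that it sends to `c`.
  obtain ⟨t, ht⟩ : (φ permElem).Nonempty :=
    hφ.nonempty ι ⟨fun _ => Sum.inr (Sum.inl 1), by simp [IsPerm]⟩
  have hex : ∀ c : F, ∃ x, Function.update t 0 x ∈ φ (mapsElem c) := by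
    intro c
    have : φ permElem ⊆ setCyl 0 (φ (mapsElem c)) := by
      rw [← hφ.cyl]
      refine hφ.mono ι ?_
      rw [ι.cyl]
      rintro s ⟨d, hd⟩
      refine ⟨Function.update s 0 (Sum.inl (d.symm c)), ?_, fun j hj => by simp [hj]⟩
      exact ⟨d.symm c, d, by simp, by simpa using hd, by simp⟩
    obtain ⟨u, hu, htu⟩ := this ht
    refine ⟨u 0, ?_⟩
    convert hu
    funext k
    by_cases hk : k = 0
    · subst hk; simp
    · simpa [hk] using htu k hk
  choose g hg using hex
  have hfun : ∀ c r r', r ∈ φ (mapsElem c) → r' ∈ φ (mapsElem c) → (∀ k, k ≠ 0 → r k = r' k) →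
      r 0 = r' 0 := by
    intro c r r' hr hr' h
    -- Injectivity of the permutation: coordinate 2 stores a second scalar with the same image `c`.
    -- This is where a third dimension is needed.
    have key : φ (mapsElem c) ∩ setCyl 0 (setDiag V 0 2 ∩ φ (mapsElem c)) ⊆ setDiag V 0 2 := by
      rw [← hφ.diag, ← hφ.meet, ← hφ.cyl, ← hφ.meet]
      refine hφ.mono ι ?_
      rw [ι.isCylMap.meet, ι.cyl, ι.isCylMap.meet, ι.diag]
      rintro s ⟨⟨b, d, h1, h2, rfl⟩, u, ⟨hu, b', d', h1', h2', h3'⟩, hsu⟩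
      change s 0 = s 2
      have hu : u 0 = u 2 := hu
      rw [← hsu 1 h01.symm, h2, Sum.inr.injEq, Sum.inl.injEq] at h2'
      subst h2'
      rw [hsu 2 h02.symm, ← hu, h1, h1', d.injective h3']
    have := @key (Function.update r 2 (r' 0)) ⟨dM c r _ ?_ hr,
      Function.update r' 2 (r' 0), ⟨?_, dM c r' _ ?_ hr'⟩, fun k hk => ?_⟩
    · simpa [setDiag, h02] using this
    · rintro k (rfl | rfl) <;> simp [h02, h12]
    · simp [setDiag, h02]
    · rintro k (rfl | rfl) <;> simp [h02, h12]
    · by_cases hk2 : k = 2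
      · subst hk2; simp
      · simpa [hk2] using h k hk
  refine ⟨g, fun c c' h => ?_, fun s => ⟨fun hs => ?_, ?_⟩⟩
  · by_contra hne
    refine hφ.not_mem_of_disjoint ι (x := mapsElem c) (y := mapsElem c') ?_ (hg c) (h ▸ hg c')
    rintro s ⟨b, d, h1, h2, rfl⟩ ⟨b', d', h1', h2', rfl⟩
    rw [h1, Sum.inl.injEq] at h1'
    rw [h2, Sum.inr.injEq, Sum.inl.injEq] at h2'
    subst h1' h2'
    exact hne rfl
  · have key : φ (meet scalarElem permElem) ⊆ ⋃ c, φ (mapsElem c) := by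
      refine hφ.subset_iUnion ι ?_
      rw [ι.isCylMap.meet]
      rintro s ⟨⟨b, hb⟩, d, hd⟩
      exact Set.mem_iUnion.2 ⟨d b, b, d, hb, hd, rfl⟩
    rw [hφ.meet] at key
    obtain ⟨c, hc⟩ := Set.mem_iUnion.1 (@key (Function.update t 0 (s 0))
      ⟨dS s _ (by rintro k rfl; simp) hs, dP t _ (by rintro k rfl; simp [h01.symm]) ht⟩)
    refine ⟨c, ?_⟩
    have := hfun c _ _ (hg c) hc fun k hk => by simp [hk]
    simpa using this
  · rintro ⟨c, hc⟩
    refine dS (Function.update t 0 (g c)) s (by rintro k rfl; simpa using hc) ?_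
    exact hφ.mono ι (x := mapsElem c) (y := scalarElem) (fun s ⟨b, d, h1, _⟩ => ⟨b, h1⟩) (hg c)

end Scalars

/-! ### The twisted algebras are not representable -/

section NotRepresentable

/-- A map of prime order without fixed points. -/
lemma prime_dvd_card_of_iterate {X : Type*} [Finite X] {p : ℕ} (hp : p.Prime) {f : X → X}
    (hf : f^[p] = id) (hne : ∀ x, f x ≠ x) : p ∣ Nat.card X := by
  classical
  have := Fintype.ofFinite X
  have : Fact p.Prime := ⟨hp⟩
  let e : Function.End X := f
  -- For a self-map of p-power order, the number of fixed points is congruent to the size of the set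
  -- modulo p.
  have he : e ^ p ^ 1 = 1 := by
    rw [pow_one]
    exact (hom_coe_pow (fun g : Function.End X => g) rfl (fun _ _ => rfl) e p).trans hf
  have h := Equiv.Perm.card_fixedPoints_modEq he
  have h0 : IsEmpty (Function.fixedPoints f) := ⟨fun x => hne x.1 x.2⟩
  rw [Nat.card_eq_fintype_card, ← Nat.modEq_zero_iff_dvd]
  exact h.trans (by rw [Fintype.card_eq_zero_iff.2 h0])

/-- A finite field of odd order has no decomposition of the complete graph on its elements into
perfect matchings indexed by the units. -/
lemma no_perfect_matchings {F : Type*} [Field F] [Finite F] (hF : Odd (Nat.card F))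
    (M : Fˣ → F → F → Prop) (hex : ∀ c a, ∃ b, M c a b) (hne : ∀ c a b, M c a b → a ≠ b)
    (hsymm : ∀ c a b, M c a b → M c b a) (hdisj : ∀ c d a b, M c a b → M d a b → c = d) :
    False := by
  classical
  have := Fintype.ofFinite F
  choose Y hY using hex
  -- There are as many colours as points other than `a`, so choosing one neighbour per colour
  -- already exhausts these points.
  have huniq : ∀ a b, M 1 a b → b = Y 1 a := by
    intro a b hab
    let f : Fˣ → {b : F // b ≠ a} := fun c => ⟨Y c a, (hne _ _ _ (hY c a)).symm⟩
    have hf : Function.Injective f := fun c d h => by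
      refine hdisj c d a _ (hY c a) ?_
      rw [show Y c a = Y d a from congrArg Subtype.val h]
      exact hY d a
    have hcard : Fintype.card Fˣ = Fintype.card {b : F // b ≠ a} := by
      rw [Fintype.card_units]
      simp [Fintype.card_subtype_compl]
    obtain ⟨c, hc⟩ := ((Fintype.bijective_iff_injective_and_card f).2 ⟨hf, hcard⟩).2
      ⟨b, (hne _ _ _ hab).symm⟩
    have hc : Y c a = b := congrArg Subtype.val hc
    rw [hdisj 1 c a b hab (hc ▸ hY c a), hc]
  have hinv : Function.Involutive (Y 1) := fun a => (huniq _ _ (hsymm _ _ _ (hY 1 a))).symm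
  exact (Nat.not_even_iff_odd.2 hF) (even_iff_two_dvd.2 (prime_dvd_card_of_iterate Nat.prime_two
    (funext hinv) fun a => (hne 1 a _ (hY 1 a)).symm))

variable {n : ℕ} {F : Type u} [Field F] [Finite F] {V : Type u}

/-- No cylindric image of a twisted algebra with an odd number of scalars carries the twisted
transposition to the true one. -/
theorem not_isCylMap_of_transp [Nonempty V] (hF : Odd (Nat.card F))
    {φ : twistedAlg (n + 3) F → Set (Fin (n + 3) → V)} (hφ : IsCylMap φ)
    (htr : ∀ x, φ (transp 0 1 x) = setTransp 0 1 (φ x)) : False := by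
  have ι := isCylRep_twistedIncl (n := n + 3) (F := F)
  have h01 : (0 : Fin (n + 3)) ≠ 1 := by simp
  have hlt : (0 : Fin (n + 3)) < 1 := by simp
  obtain ⟨g, hg, hgs⟩ := exists_scalars_eq_range hφ
  obtain ⟨w, hw⟩ : (φ (colorElem 1)).Nonempty := by
    refine hφ.nonempty ι ⟨fun k => if k = 0 then Sum.inl 0 else if k = 1 then Sum.inl 1 else
      Sum.inr (Sum.inr (k, 1, 0)), hlt, fun a b hab => ?_, fun k => ?_, fun k => ?_, ?_⟩
    · split_ifs at hab <;> simp_all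
    · split_ifs <;> simp_all [IsScalar]
    · split_ifs <;> simp [IsPerm]
    · rw [Finset.prod_eq_one]
      · simp [value, h01.symm]
      · intro k _
        split_ifs <;> rfl
  -- Freezing the remaining coordinates at those of `w` turns each colour into a binary relation.
  let pt : V → V → Fin (n + 3) → V := fun x y => Function.update (Function.update w 0 x) 1 y
  have hpt0 : ∀ x y, pt x y 0 = x := fun x y => by simp [pt, h01]
  have hpt1 : ∀ x y, pt x y 1 = y := fun x y => by simp [pt]
  have hswap : ∀ x y, pt x y ∘ Equiv.swap 0 1 = pt y x := by
    intro x y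
    funext k
    simp only [Function.comp, Equiv.swap_apply_def]
    split_ifs with h h
    · rw [h, hpt0, hpt1]
    · rw [h, hpt0, hpt1]
    · simp [pt, *]
  have hsc : ∀ {c x y}, pt x y ∈ φ (colorElem c) → x ∈ Set.range g := by
    intro c x y h
    rw [← hpt0 x y, ← hgs]
    exact hφ.mono ι (x := colorElem c) (y := scalarElem)
      (fun s hs => (HasColor.scalar hs 0).2 (Or.inl rfl)) h
  have hsym : ∀ {c x y}, pt x y ∈ φ (colorElem c) → pt y x ∈ φ (colorElem c) := by
    intro c x y h
    -- The twisted transposition keeps colours, so the true one must map the image of a colour to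
    -- itself.
    have : φ (colorElem c) ⊆ setTransp 0 1 (φ (colorElem c)) := by
      rw [← htr]
      refine hφ.mono ι fun s hs => ?_
      have hs : HasColor s 0 1 c := hs
      refine (mem_twistedIncl_transp (t := s) (Or.inl ⟨0, 1, 0, 1, c, hs, hs, fun m => ?_⟩)).2 hs
      rw [hs.scalar, hs.scalar, Equiv.swap_apply_eq_iff, Equiv.swap_apply_eq_iff,
        Equiv.swap_apply_left, Equiv.swap_apply_right, or_comm]
    rw [← hswap, ← mem_setTransp]
    exact this h
  have hexists : ∀ c, ∀ x ∈ Set.range g, ∃ y, pt x y ∈ φ (colorElem c) := by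
    intro c x hx
    have key : setCyl 0 (setCyl 1 (φ (colorElem 1))) ∩ φ scalarElem ⊆
        setCyl 1 (φ (colorElem c)) := by
      rw [← hφ.cyl, ← hφ.cyl, ← hφ.cyl, ← hφ.meet]
      refine hφ.mono ι ?_
      rw [ι.isCylMap.meet, ι.cyl, ι.cyl, ι.cyl]
      rintro s ⟨⟨r, ⟨u, hu, hru⟩, hsr⟩, b, hb⟩
      have hu : HasColor u 0 1 1 := hu
      -- Any scalar other than `b` would do at coordinate 1; the colour is corrected to `c`
      -- afterwards by `exists_update`.
      let v : Fin (n + 3) → Point (n + 3) F := Function.update (Function.update u 0 (s 0)) 1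
        (Sum.inl (b + 1))
      have hv : ∀ k, k ≠ 0 → k ≠ 1 → v k = u k := fun k h0 h1 => by simp [v, h0, h1]
      have hv0 : v 0 = Sum.inl b := by simp [v, h01, hb]
      have hv1 : v 1 = Sum.inl (b + 1) := by simp [v]
      have hvs : ∀ k, IsScalar (v k) ↔ k = 0 ∨ k = 1 := by
        intro k
        by_cases h0 : k = 0
        · subst h0; simp [hv0, IsScalar]
        by_cases h1 : k = 1
        · subst h1; simp [hv1, IsScalar]
        rw [hv k h0 h1, hu.scalar]
      obtain ⟨i, j, d, hvc⟩ : Colored v := by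
        refine exists_hasColor h01 (fun k l hkl => ?_) hvs fun k => ?_
        · have h1 := hvs k
          rw [hkl, hvs l] at h1
          by_cases hk : k = 0 ∨ k = 1
          · rcases hk with rfl | rfl <;> rcases h1.2 (by simp) with rfl | rfl
            · rfl
            · rw [hv0, hv1] at hkl; simp at hkl
            · rw [hv0, hv1] at hkl; simp at hkl
            · rfl
          · have hl : ¬ (l = 0 ∨ l = 1) := fun h => hk (h1.1 h)
            rw [not_or] at hk hl
            rw [hv k hk.1 hk.2, hv l hl.1 hl.2] at hkl
            exact hu.inj hkl
        · by_cases h0 : k = 0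
          · subst h0; simp [hv0, IsPerm]
          by_cases h1 : k = 1
          · subst h1; simp [hv1, IsPerm]
          rw [hv k h0 h1]
          exact hu.not_perm k
      obtain ⟨t, ht, h1, -⟩ := hvc.exists_update 1 c
      have hi := (hvc.scalar 0).1 ((hvs 0).2 (Or.inl rfl))
      have hj := (hvc.scalar 1).1 ((hvs 1).2 (Or.inr rfl))
      have hl := hvc.lt
      have hij : i = 0 ∧ j = 1 := by grind
      obtain ⟨rfl, rfl⟩ := hij
      refine ⟨t, ht, fun k hk => ?_⟩
      rw [← h1 k hk]
      by_cases h0 : k = 0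
      · subst h0; rw [hv0, hb]
      · rw [hsr k h0, hru k hk, hv k h0 hk]
    obtain ⟨u, hu, h⟩ := @key (Function.update w 0 x)
      ⟨⟨w, ⟨w, hw, fun _ _ => rfl⟩, fun j hj => by simp [hj]⟩, by simpa [hgs] using hx⟩
    refine ⟨u 1, ?_⟩
    convert hu
    funext k
    by_cases hk : k = 1
    · rw [hk, hpt1]
    · rw [← h k hk]
      simp [pt, hk]
  refine no_perfect_matchings hF (fun c a b => pt (g a) (g b) ∈ φ (colorElem c))
    (fun c a => ?_) (fun c a b h hab => ?_) (fun c a b h => hsym h) (fun c d a b h h' => ?_)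
  · obtain ⟨y, hy⟩ := hexists c (g a) ⟨a, rfl⟩
    obtain ⟨b, rfl⟩ := hsc (hsym hy)
    exact ⟨b, hy⟩
  · refine hφ.not_mem_of_disjoint ι (x := colorElem c) (y := diag 0 1) ?_ h ?_
    · rw [ι.diag]
      exact fun s hs e => h01 (HasColor.inj hs e)
    · rw [hφ.diag]
      simp [setDiag, hpt0, hpt1, hab]
  · by_contra hne
    exact hφ.not_mem_of_disjoint ι (x := colorElem c) (y := colorElem d)
      (fun s hs hs' => hne (HasColor.unique hs hs').2.2) h h'

end NotRepresentable

/-! ### Twisted algebras of different prime orders -/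

section Independence

variable {n : ℕ} {F F' : Type u} [Field F] [Field F']

/-- The translation of the base set. -/
def translation (n : ℕ) (F : Type u) [Field F] (a : F) : Equiv.Perm (Point n F) :=
  autOf (Equiv.addRight a)
    (Equiv.prodCongr (Equiv.refl _) (Equiv.prodCongr (Equiv.refl _) (Equiv.addRight a)))

lemma translation_zero : translation n F 0 = 1 := by
  ext (b | d | w) <;> simp [translation, autOf]

lemma translation_add (a b : F) :
    translation n F (a + b) = translation n F b * translation n F a := by
  have h : Equiv.addRight (a + b) = Equiv.addRight b * Equiv.addRight a := by
    ext; simp [add_assoc]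
  ext (c | d | w)
  · simp [translation, autOf, h]
  · change Sum.inr (Sum.inl (d * (Equiv.addRight (a + b))⁻¹)) =
      Sum.inr (Sum.inl (d * (Equiv.addRight a)⁻¹ * (Equiv.addRight b)⁻¹))
    rw [h, mul_inv_rev, mul_assoc]
  · simp [translation, autOf, Prod.ext_iff, add_assoc]

lemma translation_iterate (a : F) (k : ℕ) :
    (translation n F a)^[k] = translation n F (k • a) := by
  induction k with
  | zero => rw [zero_smul, translation_zero]; rfl
  | succ k ih => rw [Function.iterate_succ', ih, succ_nsmul, translation_add]; rfl

/-- The third component of the weights exists for this purpose only: it gives the translation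
something to move. -/
lemma translation_ne {a : F} (ha : a ≠ 0) (x : Point n F) : translation n F a x ≠ x := by
  rcases x with b | d | ⟨i, c, b⟩
  · simp [translation, autOf, ha]
  · simp only [translation, autOf, Equiv.sumCongr_apply, Sum.map_inr, Sum.map_inl,
      Equiv.coe_mulRight, ne_eq, Sum.inr.injEq, Sum.inl.injEq, mul_eq_left, inv_eq_one]
    intro h
    have := Equiv.congr_fun h 0
    simp [ha] at this
  · simp [translation, autOf, ha]

/-- A homomorphism of twisted algebras of prime orders forces the orders to be equal. -/
theorem card_eq_of_isPolyHom [Finite F] [Finite F'] (hF : (Nat.card F).Prime) (hF' : (Nat.card F').Prime)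
    {h : twistedAlg (n + 3) F → twistedAlg (n + 3) F'} (hh : IsPolyHom h) :
    Nat.card F' = Nat.card F := by
  obtain ⟨g, hg, hgs⟩ := exists_scalars_eq_range (isCylRep_twistedIncl.comp hh)
  let τ := translation (n + 3) F' 1
  have hτ : Set.MapsTo τ (Set.range g) (Set.range g) := by
    intro x hx
    -- A constant tuple is not injective, hence uncoloured, so elements of the algebra are closed
    -- under applying the automorphism `τ` to it.
    refine (hgs fun _ => τ x).1 (twistedIncl_closed _ (t := fun _ => x) (Or.inr
      ⟨fun ⟨_, _, _, hc⟩ => ?_, τ, autOf_mem _ _, fun _ => rfl⟩) ((hgs fun _ => x).2 hx))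
    have := @hc.inj 0 1 rfl
    simp at this
  have hdvd : Nat.card F' ∣ Nat.card (Set.range g) := by
    refine prime_dvd_card_of_iterate hF' (f := hτ.restrict) ?_ ?_
    · funext x
      refine Subtype.ext ?_
      rw [Set.MapsTo.iterate_restrict, Set.MapsTo.val_restrict_apply, translation_iterate,
        card_nsmul_eq_zero', translation_zero]
      rfl
    · intro x hx
      exact translation_ne one_ne_zero _ (congrArg Subtype.val hx)
  rw [Nat.card_range_of_injective hg] at hdvd
  exact (Nat.prime_dvd_prime_iff_eq hF' hF).1 hdvd

end Independence

/-! ### The number of varieties between `RPEA` and `RCPEA` -/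

/-- The field with `p` elements, in the universe of the algebras. -/
abbrev PrimeField (p : ℕ) : Type u := ULift.{u} (ZMod p)

/-- The odd prime numbers. -/
abbrev OddPrime : Type := {p : ℕ // p.Prime ∧ p ≠ 2}

instance : Infinite OddPrime :=
  (Nat.infinite_setOfPred_prime.sdiff (Set.finite_singleton 2)).to_subtype

instance (p : OddPrime) : Fact p.1.Prime := ⟨p.2.1⟩

lemma exists_equation_family (n : ℕ) : ∃ e : OddPrime → Equation (polyLang (n + 3)),
    (∀ p, e p ∈ eqTheory (Pse.{u} (n + 3))) ∧
    ∀ p q, TrueIn (twistedAlg (n + 3) (PrimeField.{u} q.1)) (e p) ↔ p ≠ q := by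
  choose e he using fun p : OddPrime =>
    exists_equation_trueIn_iff (twistedAlg (n + 3) (PrimeField.{u} p.1))
  have hcard : ∀ p : OddPrime, Nat.card (PrimeField.{u} p.1) = p.1 := fun p => by
    rw [Nat.card_ulift, Nat.card_zmod]
  refine ⟨e, fun p B hB => ?_, fun p q => ?_⟩
  · obtain ⟨U, S, rfl⟩ := hB
    -- Over an empty base the algebra has a single element, and every equation holds.
    rcases isEmpty_or_nonempty U with hU | hU
    · have : Subsingleton S := ⟨fun x y => Subtype.ext (Set.ext fun s => (hU.false (s 0)).elim)⟩
      exact fun v => Subsingleton.elim (α := S) _ _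
    · let ι : (⟨S, inferInstance⟩ : Alg.{u} (polyLang (n + 3))) → Set (Fin (n + 3) → U) :=
        fun X => Subtype.val X
      have hι : IsCylRep ι :=
        ⟨Subtype.val_injective, fun _ _ => rfl, fun _ => rfl, fun _ _ => rfl, fun _ _ => rfl⟩
      refine (he p _ U ι hι).2 fun h hh => not_isCylMap_of_transp ?_ (hι.comp hh) fun x => ?_
      · rw [hcard]
        exact p.2.1.odd_of_ne_two p.2.2
      · rw [hh.transp]
        rfl
  · rw [he p _ _ _ isCylRep_twistedIncl]
    constructor
    · rintro h rfl
      exact h _ (isPolyHom_id _)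
    · intro hpq h hh
      have := card_eq_of_isPolyHom (by rw [hcard]; exact p.2.1) (by rw [hcard]; exact q.2.1) hh
      rw [hcard, hcard] at this
      exact hpq (Subtype.ext this.symm)

instance (n l : ℕ) : Countable ((polyLang n).Functions l) := by
  have h1 : Countable (CylFunc n l) := by
    let f : CylFunc n l → Bool ⊕ Fin n ⊕ Fin n × Fin n := fun x => match x with
      | .add => .inl true
      | .neg => .inl false
      | .cyl i => .inr (.inl i)
      | .diag i j => .inr (.inr (i, j))
    refine Function.Injective.countable (f := f) fun x y h => ?_
    cases x <;> cases y <;> simp_all [f]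
  have h2 : Countable (TranspFunc n l) := by
    let f : TranspFunc n l → Fin n × Fin n := fun x => match x with
      | .transp i j => (i, j)
    refine Function.Injective.countable (f := f) fun x y h => ?_
    cases x; cases y; simp_all [f]
  exact inferInstanceAs (Countable (CylFunc n l ⊕ TranspFunc n l))

end PolyadicGap

theorem mainTheorem4 (α : ℕ) (hα : 3 ≤ α) :
    Cardinal.mk {V : Set (PolyadicGap.Alg.{u} (PolyadicGap.polyLang α)) //
      PolyadicGap.IsVariety V ∧ PolyadicGap.RPEA.{u} α ⊆ V ∧ V ⊆ PolyadicGap.RCPEA.{u} α} =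
    Cardinal.continuum.{u + 1} := by
  obtain ⟨n, rfl⟩ : ∃ n, α = n + 3 := ⟨α - 3, by omega⟩
  apply le_antisymm
  -- A variety is recovered from any set of equations defining it, and the equations form a
  -- countable set.
  · have hinj : Function.Injective (fun V : {V : Set (PolyadicGap.Alg.{u}
        (PolyadicGap.polyLang (n + 3))) // PolyadicGap.IsVariety V ∧
          PolyadicGap.RPEA.{u} (n + 3) ⊆ V ∧ V ⊆ PolyadicGap.RCPEA.{u} (n + 3)} =>
        V.2.1.choose) := fun V W h => by
      refine Subtype.ext ?_
      rw [V.2.1.choose_spec, W.2.1.choose_spec]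
      exact congrArg _ h
    have hle := Cardinal.mk_le_of_injective
      (Function.Injective.comp (Equiv.ulift.{u + 1, 0}.symm.injective) hinj)
    refine hle.trans ?_
    rw [Cardinal.mk_uLift, Cardinal.mk_set, ← Cardinal.lift_continuum.{u + 1, 0},
      Cardinal.lift_le, ← Cardinal.two_power_aleph0]
    exact Cardinal.power_le_power_left two_ne_zero Cardinal.mk_le_aleph0
  · obtain ⟨e, he, heq⟩ := PolyadicGap.exists_equation_family.{u} n
    let V : Set PolyadicGap.OddPrime → Set (PolyadicGap.Alg.{u} (PolyadicGap.polyLang (n + 3))) :=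
      fun S => PolyadicGap.models (PolyadicGap.rcpeaAxioms.{u} (n + 3) ∪ e '' S)
    -- The twisted algebras contained in `V S` are those of the primes outside `S`, so `V S`
    -- determines `S`.
    have hmem : ∀ S p, PolyadicGap.twistedAlg (n + 3) (PolyadicGap.PrimeField.{u} p.1) ∈ V S ↔
        p ∉ S := by
      intro S p
      constructor
      · intro h hp
        exact (heq p p).1 (h _ (Or.inr ⟨p, hp, rfl⟩)) rfl
      · rintro hp _ (h | ⟨q, hq, rfl⟩)
        · have := PolyadicGap.twistedAlg_mem_rcpea (n := n + 3) (F := PolyadicGap.PrimeField.{u} p.1)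
          rw [PolyadicGap.rcpea_eq_models] at this
          exact this _ h
        · exact (heq q p).2 (by rintro rfl; exact hp hq)
    have hV : ∀ S, PolyadicGap.IsVariety (V S) ∧ PolyadicGap.RPEA.{u} (n + 3) ⊆ V S ∧
        V S ⊆ PolyadicGap.RCPEA.{u} (n + 3) := by
      refine fun S => ⟨⟨_, rfl⟩, ?_, ?_⟩
      · rintro A hA _ (h | ⟨q, hq, rfl⟩)
        · exact hA _ (PolyadicGap.rcpeaAxioms_subset h)
        · exact hA _ (he q)
      · rw [PolyadicGap.rcpea_eq_models]
        exact fun A hA _ h => hA _ (Or.inl h)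
    have hinj : Function.Injective (fun S => (⟨V S, hV S⟩ : {V : Set (PolyadicGap.Alg.{u}
        (PolyadicGap.polyLang (n + 3))) // PolyadicGap.IsVariety V ∧
          PolyadicGap.RPEA.{u} (n + 3) ⊆ V ∧ V ⊆ PolyadicGap.RCPEA.{u} (n + 3)})) := by
      intro S T h
      have h : V S = V T := congrArg Subtype.val h
      ext p
      rw [← not_iff_not, ← hmem, ← hmem, h]
    have hle := Cardinal.mk_le_of_injective (hinj.comp (Equiv.ulift.{u + 1, 0}.injective))
    refine le_trans ?_ hle
    rw [Cardinal.mk_uLift, Cardinal.mk_set, ← Cardinal.lift_continuum.{u + 1, 0},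
      Cardinal.lift_le, ← Cardinal.two_power_aleph0, Cardinal.mk_eq_aleph0]
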